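/- **Setting.** Let $\pi\colon E\to M$ be a smooth real vector bundle of finite rank over a smooth $n$-dimensional manifold $M$, let $J^\infty(\pi)$ be its infinite jet space and let $\mathcal E^\infty=J^\infty(\pi)\times\mathbb R$, with $t$ the coordinate on $\mathbb R$ (smooth functions on $\mathcal E^\infty$ depend on finitely many derivatives only). Let $\kappa$ be the module of smooth sections of the pullback of $E$ to $\mathcal E^\infty$, and $\hat\kappa$ the module of smooth sections of the pullback of $\operatorname{Hom}(E,\Lambda^nT^*M)$. A $\mathcal C$-differential operator is one that in coordinates is a matrix of total derivative operators $\sum_\sigma a^\sigma D_\sigma$ in the variables $x\in M$ (with coefficients that may depend on $t$), of finite order; its adjoint is given in coordinates by $\bigl(\sum_\sigma a^\sigma D_\sigma\bigr)^*=\sum_\sigma(-1)^{|\sigma|}D_\sigma\circ (a^\sigma)^{T}$. A multidifferential operator is a map of several arguments that is a $\mathcal C$-differential operator in each argument, of an order bounded over all choices of the other arguments. Let $u_t=f$, $f\in\kappa$, be an evolution equation. Let $\ell_f\colon\kappa\to\kappa$, $\ell_f(\alpha)=\partial_\alpha(f)$, be the linearization of $f$ (where $\partial_\alpha$ is the evolutionary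 vector field with generating section $\alpha$, in coordinates $\partial_\alpha=\sum_{j,\sigma}D_\sigma(\alpha^j)\,\partial/\partial u^j_\sigma$), let $D_t=\partial/\partial t+\partial_f$, and let $\ell_{\mathcal E}=D_t-\ell_f\colon\kappa\to\kappa$ and $\ell_{\mathcal E}^*=-D_t-\ell_f^*\colon\hat\kappa\to\hat\kappa$. The symbol of $\ell_f$, an operator of order $l$, is called nonsingular at a point of $\mathcal E^\infty$ over $x\in M$ if its determinant there is not the zero polynomial on $T^*_xM$, i.e. if the symbol of degree $l$ is invertible for some covector. **Theorem.** Suppose that the symbol of $\ell_f$ is nonsingular on a dense open subset of $\mathcal E^\infty$ and that $\operatorname{ord}\ell_f>1$. Let $k\ge 3$. 1. If $A\colon\hat\kappa\times\dots\times\hat\kappa\to\kappa$ ($k-1$ arguments) is a multidifferential operator with $$\nabla\bigl(A(\xi_1,\dots,\xi_{k-1})\bigr)+\sum_{i=1}^{k-1}A\bigl(\xi_1,\dots,\xi_{i-1},\nabla^*(\xi_i),\xi_{i+1},\dots,\xi_{k-1}\bigr)=0\qquad\text{for all }\xi_1,\dots,\xi_{k-1}\in\hat\kappa,$$ where $\nabla=\ell_{\mathcal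 E}$ and $\nabla^*=\ell_{\mathcal E}^*$, then $A=0$. 2. If $A\colon\kappa\times\dots\times\kappa\to\hat\kappa$ ($k-1$ arguments) is a multidifferential operator that satisfies the same equation for all $\xi_1,\dots,\xi_{k-1}\in\kappa$, with $\nabla=\ell_{\mathcal E}^*$ and $\nabla^*=\ell_{\mathcal E}$, then $A=0$. In particular, the equation carries no nonzero variational $k$-vectors and no nonzero variational $k$-forms for $k\ge 3$, that is, no nonzero multidifferential operators $A\colon\hat\kappa^{\,k-1}\to\kappa$, respectively $A\colon\kappa^{k-1}\to\hat\kappa$, that are skew-symmetric, skew-adjoint in each argument, and have zero Lie derivative along $D_t$: $$L(A(\xi_1,\dots,\xi_{k-1}))-\sum_iA(\xi_1,\dots,L(\xi_i),\dots,\xi_{k-1})=0,$$ where $L=\ell_{\mathcal E}$ on $\kappa$ and $L=-\ell_{\mathcal E}^*$ on $\hat\kappa$. -/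

import Mathlib

open Set Filter Topology Bundle
open scoped Manifold ContDiff BigOperators

noncomputable section

set_option linter.unusedSectionVars false
set_option synthInstance.maxHeartbeats 200000

namespace EvolEq

abbrev Eu (n : ℕ) : Type := EuclideanSpace ℝ (Fin n)

section Jets

variable (n : ℕ) {M : Type*} [TopologicalSpace M] [ChartedSpace (Eu n) M]
  (F : Type*) [NormedAddCommGroup F] [NormedSpace ℝ F]
  (E : M → Type*) [TopologicalSpace (TotalSpace F E)] [∀ x, AddCommGroup (E x)]
  [∀ x, Module ℝ (E x)] [∀ x, TopologicalSpace (E x)] [FiberBundle F E] [VectorBundle ℝ F E]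

/-- The coordinates of a vector `v` of the fibre over `x`, in the preferred trivialization around
`x₀` (a linear isomorphism onto the model fibre for `x` near `x₀`). -/
def fib (x₀ x : M) : E x →L[ℝ] F := (trivializationAt F E x₀).continuousLinearMapAt ℝ x

/-- The coordinate expression of a section in the preferred chart and trivialization around `x₀`. -/
def localRep (x₀ : M) (σ : ∀ x, E x) : Eu n → F :=
  fun y => fib F E x₀ ((chartAt (Eu n) x₀).symm y) (σ ((chartAt (Eu n) x₀).symm y))

/-- Coordinates on the fibres of the `k`-jet space: all derivatives of order at most `k`. -/
abbrev JetCoord (k : ℕ) : Type _ := (i : Fin (k + 1)) → ContinuousMultilinearMap ℝ (fun _ : Fin i => Eu n) F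

/-- The derivatives up to order `k` at the point `y` of a function `u : ℝⁿ → F`. -/
def jetOf (k : ℕ) (u : Eu n → F) (y : Eu n) : JetCoord n F k := fun i => iteratedFDeriv ℝ i u y

/-- Smooth sections of the bundle `π : E → M`. -/
abbrev Sec : Type _ := ContMDiffSection (𝓡 n) F ∞ E

/-- Two sections have the same infinite jet at `x`: all their derivatives at `x` agree, in all
coordinate systems. -/
def jetSetoid (x : M) : Setoid (Sec n F E) where
  r s s' := ∀ x₀ : M, x ∈ (chartAt (Eu n) x₀).source → x ∈ (trivializationAt F E x₀).baseSet →
    ∀ i : ℕ, iteratedFDeriv ℝ i (localRep n F E x₀ s) (chartAt (Eu n) x₀ x) =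
      iteratedFDeriv ℝ i (localRep n F E x₀ s') (chartAt (Eu n) x₀ x)
  iseqv := ⟨fun _ _ _ _ _ => rfl, fun h x₀ h₁ h₂ i => (h x₀ h₁ h₂ i).symm,
    fun h h' x₀ h₁ h₂ i => (h x₀ h₁ h₂ i).trans (h' x₀ h₁ h₂ i)⟩

/-- The infinite jet space `J^∞(π)`. -/
def JInf : Type _ := Σ x : M, Quotient (jetSetoid n F E x)

/-- The space `ℰ^∞ = J^∞(π) × ℝ` underlying an evolution equation. -/
def EInf : Type _ := JInf n F E × ℝ

variable {n F E}

/-- The projection `ℰ^∞ → M`. -/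
def EInf.base (ρ : EInf n F E) : M := ρ.1.1

/-- The point `(j_x^∞ s, t)` of `ℰ^∞`. -/
def pt (x : M) (s : Sec n F E) (t : ℝ) : EInf n F E := (⟨x, Quotient.mk _ s⟩, t)

/-- The time coordinate. -/
def EInf.time (ρ : EInf n F E) : ℝ := ρ.2

/-- A section of `π` representing the jet of a point of `ℰ^∞`. -/
def EInf.sec (ρ : EInf n F E) : Sec n F E := ρ.1.2.out

theorem EInf.pt_eta (ρ : EInf n F E) : pt ρ.base ρ.sec ρ.time = ρ := by
  obtain ⟨⟨x, q⟩, t⟩ := ρ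
  show ((⟨x, Quotient.mk _ q.out⟩, t) : JInf n F E × ℝ) = (⟨x, q⟩, t)
  rw [Quotient.out_eq]

end Jets

section Functions

variable {n : ℕ} {M : Type*} [TopologicalSpace M] [ChartedSpace (Eu n) M] [IsManifold (𝓡 n) ∞ M]
  {F : Type*} [NormedAddCommGroup F] [NormedSpace ℝ F]
  {E : M → Type*} [TopologicalSpace (TotalSpace F E)] [∀ x, AddCommGroup (E x)]
  [∀ x, Module ℝ (E x)] [∀ x, TopologicalSpace (E x)] [FiberBundle F E] [VectorBundle ℝ F E]
  {G : Type*} [NormedAddCommGroup G] [NormedSpace ℝ G]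
  {V : M → Type*} [TopologicalSpace (TotalSpace G V)] [∀ x, AddCommGroup (V x)]
  [∀ x, Module ℝ (V x)] [∀ x, TopologicalSpace (V x)] [FiberBundle G V] [VectorBundle ℝ G V]

/-- In the coordinate system around `x₀`, the section `p` over `ℰ^∞` is given by the function `g`
of the time, of the point of `M` and of the derivatives up to order `k`. -/
def IsLocalExpr (x₀ : M) (k : ℕ) (p : ∀ ρ : EInf n F E, V ρ.base)
    (g : ℝ × Eu n × JetCoord n F k → G) : Prop :=
  ∀ᶠ x in 𝓝 x₀, ∀ (s : Sec n F E) (t : ℝ), fib G V x₀ x (p (pt x s t)) =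
    g (t, chartAt (Eu n) x₀ x, jetOf n F k (localRep n F E x₀ s) (chartAt (Eu n) x₀ x))

variable (G) in
/-- `p` is a smooth function of `t`, `x` and of the derivatives up to order `k`. -/
def IsSmoothOfOrder (k : ℕ) (p : ∀ ρ : EInf n F E, V ρ.base) : Prop :=
  ∀ x₀ : M, ∃ g : ℝ × Eu n × JetCoord n F k → G, ContDiff ℝ ∞ g ∧ IsLocalExpr x₀ k p g

/-- Forgetting the derivatives of order greater than `k`. -/
def jetTrunc {k k' : ℕ} (h : k ≤ k') : JetCoord n F k' →L[ℝ] JetCoord n F k :=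
  ContinuousLinearMap.pi fun i => ContinuousLinearMap.proj (R := ℝ)
    (φ := fun i : Fin (k' + 1) => ContinuousMultilinearMap ℝ (fun _ : Fin i => Eu n) F)
    (Fin.castLE (Nat.succ_le_succ h) i)

theorem jetTrunc_jetOf {k k' : ℕ} (h : k ≤ k') (u : Eu n → F) (y : Eu n) :
    jetTrunc h (jetOf n F k' u y) = jetOf n F k u y := rfl

theorem IsSmoothOfOrder.mono {k k' : ℕ} (h : k ≤ k') {p : ∀ ρ : EInf n F E, V ρ.base}
    (hp : IsSmoothOfOrder G k p) : IsSmoothOfOrder G k' p := by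
  intro x₀
  obtain ⟨g, hg, hp⟩ := hp x₀
  refine ⟨fun z => g (z.1, z.2.1, jetTrunc h z.2.2), by fun_prop, ?_⟩
  filter_upwards [hp] with x hx s t
  simpa [jetTrunc_jetOf] using hx s t

variable (n F E G V) in
/-- The module of smooth sections over `ℰ^∞` of the bundle pulled back from a vector bundle `V`
over `M`. As usual, smooth functions on `ℰ^∞` depend on finitely many derivatives only. -/
def Gam : Submodule ℝ (∀ ρ : EInf n F E, V ρ.base) where
  carrier := {p | ∃ k, IsSmoothOfOrder G k p}
  zero_mem' := ⟨0, fun x₀ => ⟨0, contDiff_const, Eventually.of_forall fun x s t => by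
    simp only [Pi.zero_apply]; exact map_zero _⟩⟩
  add_mem' := by
    rintro p q ⟨k, hp⟩ ⟨l, hq⟩
    refine ⟨max k l, fun x₀ => ?_⟩
    obtain ⟨g, hg, hp⟩ := (hp.mono (le_max_left k l)) x₀
    obtain ⟨g', hg', hq⟩ := (hq.mono (le_max_right k l)) x₀
    refine ⟨g + g', hg.add hg', ?_⟩
    filter_upwards [hp, hq] with x h h' s t
    rw [Pi.add_apply, Pi.add_apply, ← h, ← h']
    exact map_add _ _ _
  smul_mem' := by
    rintro c p ⟨k, hp⟩
    refine ⟨k, fun x₀ => ?_⟩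
    obtain ⟨g, hg, hp⟩ := hp x₀
    refine ⟨c • g, hg.const_smul c, ?_⟩
    filter_upwards [hp] with x h s t
    rw [Pi.smul_apply, Pi.smul_apply, ← h]
    exact map_smul _ _ _

instance : AddCommGroup (Gam n F E G V) := Submodule.addCommGroup _

theorem exists_contDiff_eventuallyEq {W : Type*} [NormedAddCommGroup W] [NormedSpace ℝ W]
    [FiniteDimensional ℝ W] {h : W → ℝ} {y₀ : W}
    (hh : ∀ᶠ y in 𝓝 y₀, ContDiffAt ℝ ∞ h y) : ∃ H : W → ℝ, ContDiff ℝ ∞ H ∧ H =ᶠ[𝓝 y₀] h := by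
  obtain ⟨ε, hε, hb⟩ := Metric.eventually_nhds_iff_ball.1 hh
  let b : ContDiffBump y₀ := ⟨ε / 4, ε / 2, by positivity, by linarith⟩
  refine ⟨fun y => b y * h y, ?_, ?_⟩
  · rw [contDiff_iff_contDiffAt]
    intro y
    by_cases hy : y ∈ tsupport b
    · have : y ∈ Metric.ball y₀ ε := by
        rw [b.tsupport_eq] at hy
        have := Metric.mem_closedBall.1 hy
        simp only [b] at this
        exact Metric.mem_ball.2 (by linarith)
      exact b.contDiff.contDiffAt.mul (hb y this)
    · have h0 : b =ᶠ[𝓝 y] 0 := notMem_tsupport_iff_eventuallyEq.1 hy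
      refine (contDiffAt_const (c := (0 : ℝ))).congr_of_eventuallyEq ?_
      filter_upwards [h0] with z hz
      simp [hz]
  · filter_upwards [b.eventuallyEq_one] with y hy
    simp [hy]

/-- Repeated total differentiation: the derivatives of `y ↦ g(t, y, u(y), …, u^{(k)}(y))` are smooth
functions of `t`, `y` and of the derivatives of `u`. -/
theorem exists_prolongation {F G : Type*} [NormedAddCommGroup F] [NormedSpace ℝ F]
    [NormedAddCommGroup G] [NormedSpace ℝ G] {n k : ℕ} {g : ℝ × Eu n × JetCoord n F k → G}
    (hg : ContDiff ℝ ∞ g) (i : ℕ) :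
    ∃ gi : ℝ × Eu n × JetCoord n F (k + i) → ContinuousMultilinearMap ℝ (fun _ : Fin i => Eu n) G,
      ContDiff ℝ ∞ gi ∧ ∀ (t : ℝ) (u : Eu n → F) (y : Eu n),
        (∀ᶠ z in 𝓝 y, ContDiffAt ℝ ∞ u z) →
        iteratedFDeriv ℝ i (fun z => g (t, z, jetOf n F k u z)) y =
          gi (t, y, jetOf n F (k + i) u y) := by
  induction i with
  | zero =>
    refine ⟨fun z => (continuousMultilinearCurryFin0 ℝ (Eu n) G).symm (g z),
      (LinearIsometryEquiv.contDiff _).comp hg, fun t u y _ => ?_⟩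
    rw [iteratedFDeriv_zero_eq_comp]
    rfl
  | succ i ih =>
    obtain ⟨gi, hgi, h⟩ := ih
    let C : ∀ j : Fin (k + i + 1), JetCoord n F (k + (i + 1)) →
        (Eu n →L[ℝ] ContinuousMultilinearMap ℝ (fun _ : Fin j => Eu n) F) := fun j J =>
      continuousMultilinearCurryLeftEquiv ℝ (fun _ : Fin (j + 1) => Eu n) F
        (J ⟨j + 1, by omega⟩)
    have hC : ∀ j, ContDiff ℝ ∞ (C j) := fun j =>
      (LinearIsometryEquiv.contDiff _).comp (ContinuousLinearMap.contDiff
        (ContinuousLinearMap.proj (R := ℝ) (φ := fun i : Fin (k + (i + 1) + 1) =>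
          ContinuousMultilinearMap ℝ (fun _ : Fin i => Eu n) F) ⟨j + 1, by omega⟩))
    let T : JetCoord n F (k + (i + 1)) → (Eu n →L[ℝ] ℝ × Eu n × JetCoord n F (k + i)) := fun J =>
      (0 : Eu n →L[ℝ] ℝ).prod ((ContinuousLinearMap.id ℝ (Eu n)).prod
        (ContinuousLinearMap.pi fun j => C j J))
    have hT : ContDiff ℝ ∞ T := by
      rw [contDiff_clm_apply_iff]
      intro v
      refine contDiff_const.prodMk (contDiff_const.prodMk (contDiff_pi.2 fun j => ?_))
      exact (hC j).clm_apply contDiff_const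
    let R : JetCoord n F (k + (i + 1)) →L[ℝ] JetCoord n F (k + i) := jetTrunc (by omega)
    refine ⟨fun z => (continuousMultilinearCurryLeftEquiv ℝ (fun _ : Fin (i + 1) => Eu n) G).symm
      ((fderiv ℝ gi (z.1, z.2.1, R z.2.2)).comp (T z.2.2)), ?_, fun t u y hu => ?_⟩
    · refine (LinearIsometryEquiv.contDiff _).comp (ContDiff.clm_comp ?_ ?_)
      · exact (hgi.fderiv_right (m := ∞) (by simp)).comp (by fun_prop)
      · exact hT.comp (by fun_prop)
    · rw [iteratedFDeriv_succ_eq_comp_left]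
      simp only [Function.comp_apply]
      congr 1
      have h1 : iteratedFDeriv ℝ i (fun z => g (t, z, jetOf n F k u z)) =ᶠ[𝓝 y]
          fun z => gi (t, z, jetOf n F (k + i) u z) := by
        filter_upwards [hu.eventually_nhds] with z hz
        exact h t u z hz
      rw [h1.fderiv_eq]
      have h2 : HasFDerivAt (fun z => (t, z, jetOf n F (k + i) u z))
          (T (jetOf n F (k + (i + 1)) u y)) y := by
        refine (hasFDerivAt_const t y).prodMk ((hasFDerivAt_id y).prodMk (hasFDerivAt_pi.2
          fun j => ?_))
        have h3 : ContDiffAt ℝ ∞ (iteratedFDeriv ℝ j u) y :=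
          hu.self_of_nhds.iteratedFDeriv_right (m := ∞) (i := _) le_rfl
        exact (h3.differentiableAt (by simp)).hasFDerivAt
      exact (((hgi.differentiable (by simp)).differentiableAt).hasFDerivAt.comp y h2).fderiv

/-- Multiplication of a section by a smooth function on `M`. -/
def smulBase (a : C^∞⟮𝓡 n, M; 𝓘(ℝ), ℝ⟯) (p : Gam n F E G V) : Gam n F E G V :=
  ⟨fun ρ => a ρ.base • p.1 ρ, by
    obtain ⟨p, k, hp⟩ := p
    refine ⟨k, fun x₀ => ?_⟩
    obtain ⟨g, hg, hp⟩ := hp x₀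
    obtain ⟨H, hH, hHa⟩ := exists_contDiff_eventuallyEq
      (h := fun y => a ((chartAt (Eu n) x₀).symm y)) (y₀ := chartAt (Eu n) x₀ x₀) (by
        filter_upwards [(chartAt (Eu n) x₀).open_target.mem_nhds (mem_chart_target _ x₀)] with y hy
        have h1 := (contMDiffOn_chart_symm (I := 𝓡 n) (n := ∞) (x := x₀)).contMDiffAt
          ((chartAt (Eu n) x₀).open_target.mem_nhds hy)
        exact ((a.contMDiff.contMDiffAt).comp y h1).contDiffAt)
    refine ⟨fun z => H z.2.1 • g z, by fun_prop, ?_⟩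
    have hc := (chartAt (Eu n) x₀).continuousAt (mem_chart_source _ x₀)
    filter_upwards [hp, hc.eventually hHa,
      (chartAt (Eu n) x₀).open_source.mem_nhds (mem_chart_source _ x₀)] with x hx h2 h3 s t
    rw [← hx s t, h2, (chartAt (Eu n) x₀).left_inv h3]
    exact map_smul _ _ _⟩

/-- The topology of `ℰ^∞`: the coarsest one for which all smooth functions are continuous. -/
instance : TopologicalSpace (EInf n F E) :=
  ⨅ a : Gam n F E ℝ (Bundle.Trivial M ℝ), TopologicalSpace.induced a.1 inferInstance

variable (G V) in
/-- The derivative at `τ` of a curve in the fibre of `V` over `x` (a finite-dimensional vector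
space, identified with the model fibre by a linear isomorphism). -/
def fibDeriv (x : M) (c : ℝ → V x) (τ : ℝ) : V x :=
  (trivializationAt G V x).symmL ℝ x (deriv (fun τ' => fib G V x x (c τ')) τ)

theorem fib_fibDeriv {x₀ x : M} (hx : x ∈ (trivializationAt G V x₀).baseSet) {c : ℝ → V x}
    {τ : ℝ} {d : G} (h : HasDerivAt (fun τ' => fib G V x₀ x (c τ')) d τ) :
    fib G V x₀ x (fibDeriv G V x c τ) = d := by
  have hxx : x ∈ (trivializationAt G V x).baseSet := mem_baseSet_trivializationAt G V x
  let L : G →L[ℝ] G := (fib G V x x).comp ((trivializationAt G V x₀).symmL ℝ x)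
  have h1 : (fun τ' => fib G V x x (c τ')) = fun τ' => L (fib G V x₀ x (c τ')) := by
    funext τ'
    simp only [L, fib, ContinuousLinearMap.comp_apply]
    rw [Trivialization.symmL_continuousLinearMapAt _ hx]
  have h2 : deriv (fun τ' => fib G V x x (c τ')) τ = L d := by
    rw [h1]; exact (L.hasFDerivAt.comp_hasDerivAt τ h).deriv
  unfold fibDeriv
  rw [h2]
  simp only [L, fib, ContinuousLinearMap.comp_apply]
  rw [Trivialization.symmL_continuousLinearMapAt _ hxx,
    Trivialization.continuousLinearMapAt_symmL _ hx]

/-- The partial derivative `∂/∂t`. -/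
def timeDeriv (p : Gam n F E G V) : Gam n F E G V :=
  ⟨fun ρ => fibDeriv G V ρ.base (fun τ => p.1 (ρ.1, τ)) ρ.2, by
    obtain ⟨p, k, hp⟩ := p
    refine ⟨k, fun x₀ => ?_⟩
    obtain ⟨g, hg, hp⟩ := hp x₀
    refine ⟨fun z => fderiv ℝ g z (1, 0), ?_, ?_⟩
    · exact (hg.fderiv_right (m := ∞) (by simp)).clm_apply contDiff_const
    · filter_upwards [hp, (trivializationAt G V x₀).open_baseSet.mem_nhds
        (mem_baseSet_trivializationAt G V x₀)] with x h hx s t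
      refine fib_fibDeriv hx ?_
      have h1 : (fun τ => fib G V x₀ x (p ((pt x s t).1, τ))) = fun τ => g (τ,
        (chartAt (Eu n) x₀ x, jetOf n F k (localRep n F E x₀ s) (chartAt (Eu n) x₀ x))) :=
        funext fun τ => h s τ
      have h2 : HasDerivAt (fun τ : ℝ => (τ,
        (chartAt (Eu n) x₀ x, jetOf n F k (localRep n F E x₀ s) (chartAt (Eu n) x₀ x))))
        ((1 : ℝ), (0 : Eu n × JetCoord n F k)) t := (hasDerivAt_id t).prodMk (hasDerivAt_const t _)
      have h3 := ((hg.differentiable (by simp)).differentiableAt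
        (x := (t, chartAt (Eu n) x₀ x, jetOf n F k (localRep n F E x₀ s)
          (chartAt (Eu n) x₀ x)))).hasFDerivAt.comp_hasDerivAt t h2
      change HasDerivAt (fun τ => fib G V x₀ x (p ((pt x s t).1, τ))) _ t
      rw [h1]
      exact h3⟩

variable [ContMDiffVectorBundle ∞ F E (𝓡 n)]

theorem eventually_contDiffAt_localRep (s : Sec n F E) {x₀ x : M}
    (hx : x ∈ (chartAt (Eu n) x₀).source) (hx' : x ∈ (trivializationAt F E x₀).baseSet) :
    ∀ᶠ y in 𝓝 (chartAt (Eu n) x₀ x), ContDiffAt ℝ ∞ (localRep n F E x₀ s) y := by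
  have hc := (chartAt (Eu n) x₀).continuousAt_symm ((chartAt (Eu n) x₀).map_source hx)
  have hb : ∀ᶠ z in 𝓝 ((chartAt (Eu n) x₀).symm (chartAt (Eu n) x₀ x)),
      z ∈ (trivializationAt F E x₀).baseSet := by
    rw [(chartAt (Eu n) x₀).left_inv hx]
    exact (trivializationAt F E x₀).open_baseSet.mem_nhds hx'
  filter_upwards [(chartAt (Eu n) x₀).open_target.mem_nhds ((chartAt (Eu n) x₀).map_source hx),
    (hc.eventually hb).eventually_nhds] with y hy hz
  have h1 := (contMDiffOn_chart_symm (I := 𝓡 n) (n := ∞) (x := x₀)).contMDiffAt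
    ((chartAt (Eu n) x₀).open_target.mem_nhds hy)
  have h2 := (((trivializationAt F E x₀).contMDiffAt_section_iff (IB := 𝓡 n)
    hz.self_of_nhds).1 (s.contMDiff.contMDiffAt (x := (chartAt (Eu n) x₀).symm y)))
  refine (ContMDiffAt.contDiffAt (h2.comp y h1)).congr_of_eventuallyEq ?_
  filter_upwards [hz] with z hz
  exact (trivializationAt F E x₀).continuousLinearMapAt_apply_of_mem ℝ hz _

theorem IsLocalExpr.eventuallyEq {p : ∀ ρ : EInf n F E, V ρ.base} {x₀ : M} {k : ℕ}
    {g : ℝ × Eu n × JetCoord n F k → G} (h : IsLocalExpr x₀ k p g) :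
    ∀ᶠ x in 𝓝 x₀, ∀ (s : Sec n F E) (t : ℝ),
      localRep n G V x₀ (fun x => p (pt x s t)) =ᶠ[𝓝 (chartAt (Eu n) x₀ x)]
        fun y => g (t, y, jetOf n F k (localRep n F E x₀ s) y) := by
  filter_upwards [eventually_eventually_nhds.2 h,
    (chartAt (Eu n) x₀).open_source.mem_nhds (mem_chart_source _ x₀)] with x hx hxs s t
  have hc := (chartAt (Eu n) x₀).continuousAt_symm ((chartAt (Eu n) x₀).map_source hxs)
  rw [ContinuousAt, (chartAt (Eu n) x₀).left_inv hxs] at hc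
  filter_upwards [hc.eventually hx,
    (chartAt (Eu n) x₀).open_target.mem_nhds ((chartAt (Eu n) x₀).map_source hxs)] with y hy hyt
  have := hy s t
  rw [(chartAt (Eu n) x₀).right_inv hyt] at this
  exact this

/-- The section `x ↦ α(j_x^∞ s, t)` of `π`, for a section `s` of `π` and a time `t`. -/
def along (α : Gam n F E F E) (s : Sec n F E) (t : ℝ) : Sec n F E :=
  ⟨fun x => α.1 (pt x s t), by
    obtain ⟨α, k, hα⟩ := α
    intro x₀
    obtain ⟨g, hg, h⟩ := hα x₀
    have hs := mem_chart_source (Eu n) x₀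
    have hb := mem_baseSet_trivializationAt F E x₀
    refine (contMDiffAt_section (E := E) (s := fun x => α (pt x s t)) x₀).2 ?_
    have hJ : ContDiffAt ℝ ∞ (fun y => g (t, y, jetOf n F k (localRep n F E x₀ s) y))
        (chartAt (Eu n) x₀ x₀) := by
      refine hg.contDiffAt.comp _ (contDiffAt_const.prodMk (contDiffAt_id.prodMk
        (contDiffAt_pi.2 fun i => ?_)))
      exact (eventually_contDiffAt_localRep s hs hb).self_of_nhds.iteratedFDeriv_right (m := ∞) (i := _) le_rfl
    have hc := (contMDiffOn_chart (I := 𝓡 n) (n := ∞) (x := x₀)).contMDiffAt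
      ((chartAt (Eu n) x₀).open_source.mem_nhds hs)
    refine (hJ.contMDiffAt.comp x₀ hc).congr_of_eventuallyEq ?_
    filter_upwards [h, (trivializationAt F E x₀).open_baseSet.mem_nhds hb] with x hx hxb
    exact ((trivializationAt F E x₀).continuousLinearMapAt_apply_of_mem ℝ hxb _).symm.trans
      (hx s t)⟩

theorem exists_lin_expr {k k' : ℕ} {p : ∀ ρ : EInf n F E, V ρ.base} (hp : IsSmoothOfOrder G k p)
    {α : Gam n F E F E} (hα : IsSmoothOfOrder F k' α.1) (x₀ : M) :
    ∃ g : ℝ × Eu n × JetCoord n F (k' + k) → G, ContDiff ℝ ∞ g ∧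
      ∀ᶠ x in 𝓝 x₀, ∀ (s : Sec n F E) (t : ℝ), fib G V x₀ x
        (fibDeriv G V x (fun ε => p (pt x (s + ε • along α s t) t)) 0) =
        g (t, chartAt (Eu n) x₀ x, jetOf n F (k' + k) (localRep n F E x₀ s) (chartAt (Eu n) x₀ x)) := by
  obtain ⟨g, hg, h⟩ := hp x₀
  obtain ⟨a, ha, h'⟩ := hα x₀
  choose ai hai hi using fun i : ℕ => exists_prolongation ha i
  let R : JetCoord n F (k' + k) →L[ℝ] JetCoord n F k := jetTrunc (by omega)
  let R' : ∀ i : Fin (k + 1), JetCoord n F (k' + k) →L[ℝ] JetCoord n F (k' + i) := fun i =>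
    jetTrunc (by omega)
  refine ⟨fun z => fderiv ℝ g (z.1, z.2.1, R z.2.2)
    (0, 0, fun i => ai i (z.1, z.2.1, R' i z.2.2)), ?_, ?_⟩
  · refine ContDiff.clm_apply ((hg.fderiv_right (m := ∞) (by simp)).comp (by fun_prop)) ?_
    exact contDiff_const.prodMk (contDiff_const.prodMk (contDiff_pi.2 fun i =>
      (hai i).comp (by fun_prop)))
  · filter_upwards [h, h'.eventuallyEq,
      (trivializationAt G V x₀).open_baseSet.mem_nhds (mem_baseSet_trivializationAt G V x₀),
      (trivializationAt F E x₀).open_baseSet.mem_nhds (mem_baseSet_trivializationAt F E x₀),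
      (chartAt (Eu n) x₀).open_source.mem_nhds (mem_chart_source _ x₀)] with x hx hx' hb hb' hs s t
    refine fib_fibDeriv hb ?_
    set y := chartAt (Eu n) x₀ x with hy
    set σ := along α s t with hσ
    have e1 : ∀ ε : ℝ, jetOf n F k (localRep n F E x₀ (s + ε • σ : Sec n F E)) y =
        jetOf n F k (localRep n F E x₀ s) y + ε • jetOf n F k (localRep n F E x₀ σ) y := by
      intro ε
      have e2 : localRep n F E x₀ (s + ε • σ : Sec n F E) =
          localRep n F E x₀ s + ε • localRep n F E x₀ σ := by
        funext z
        simp [localRep]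
      funext i
      have c1 := (eventually_contDiffAt_localRep s hs hb').self_of_nhds.of_le
        (show ((i : ℕ) : WithTop ℕ∞) ≤ ∞ by exact_mod_cast le_top)
      have c2 := (eventually_contDiffAt_localRep σ hs hb').self_of_nhds.of_le
        (show ((i : ℕ) : WithTop ℕ∞) ≤ ∞ by exact_mod_cast le_top)
      simp only [jetOf, Pi.add_apply, Pi.smul_apply]
      rw [e2]
      refine (iteratedFDeriv_add_apply (g := ε • localRep n F E x₀ σ) c1 (c2.const_smul ε)).trans ?_
      rw [iteratedFDeriv_const_smul_apply c2]
    have e3 : jetOf n F k (localRep n F E x₀ σ) y =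
        fun i : Fin (k + 1) => ai i (t, y, R' i (jetOf n F (k' + k) (localRep n F E x₀ s) y)) := by
      funext i
      have := (hx' s t).iteratedFDeriv ℝ i
      refine this.self_of_nhds.trans ?_
      exact hi i t _ y (eventually_contDiffAt_localRep s hs hb')
    have h1 : (fun ε : ℝ => fib G V x₀ x (p (pt x (s + ε • σ) t))) = fun ε => g (t, y,
        jetOf n F k (localRep n F E x₀ s) y + ε • jetOf n F k (localRep n F E x₀ σ) y) := by
      funext ε
      rw [hx, e1]
    rw [h1, ← e3]
    have h2 : HasDerivAt (fun ε : ℝ => (t, y, jetOf n F k (localRep n F E x₀ s) y +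
        ε • jetOf n F k (localRep n F E x₀ σ) y))
        ((0 : ℝ), (0 : Eu n), jetOf n F k (localRep n F E x₀ σ) y) 0 := by
      refine (hasDerivAt_const _ _).prodMk ((hasDerivAt_const _ _).prodMk ?_)
      simpa using ((hasDerivAt_id (0 : ℝ)).smul_const
        (jetOf n F k (localRep n F E x₀ σ) y)).const_add (jetOf n F k (localRep n F E x₀ s) y)
    have h3 := (hg.differentiable (by simp)).differentiableAt.hasFDerivAt.comp_hasDerivAt _ h2
    rw [zero_smul, add_zero] at h3
    exact h3

/-- The linearization `ℓ_p` of `p`, `ℓ_p(α) = Э_α(p)`: the derivative of `p` along the evolutionary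
field of `α`, that is, along the infinitesimal deformation `s + ε α(s)` of sections `s`. -/
def lin (p : Gam n F E G V) (α : Gam n F E F E) : Gam n F E G V :=
  ⟨fun ρ => fibDeriv G V ρ.base
    (fun ε => p.1 (pt ρ.base (ρ.sec + ε • along α ρ.sec ρ.time) ρ.time)) 0, by
    obtain ⟨p, k, hp⟩ := p
    obtain ⟨k', hα⟩ := α.2
    refine ⟨k' + k, fun x₀ => ?_⟩
    obtain ⟨g, hg, h⟩ := exists_lin_expr hp hα x₀
    refine ⟨g, hg, ?_⟩
    filter_upwards [h,
      (trivializationAt F E x₀).open_baseSet.mem_nhds (mem_baseSet_trivializationAt F E x₀),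
      (chartAt (Eu n) x₀).open_source.mem_nhds (mem_chart_source _ x₀)] with x hx hb hs s t
    refine (hx (pt x s t).sec t).trans ?_
    congr 3
    funext i
    exact Quotient.mk_out (s := jetSetoid n F E x) s x₀ hs hb i⟩

theorem lin_pt (p : Gam n F E G V) (α : Gam n F E F E) (x : M) (s : Sec n F E) (t : ℝ) :
    (lin p α).1 (pt x s t) = fibDeriv G V x (fun ε => p.1 (pt x (s + ε • along α s t) t)) 0 := by
  obtain ⟨k, hp⟩ := p.2
  obtain ⟨k', hα⟩ := α.2
  obtain ⟨g, hg, h⟩ := exists_lin_expr hp hα x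
  have hb := mem_baseSet_trivializationAt G V x
  have h0 := h.self_of_nhds
  have h1 := (h0 (pt x s t).sec t).trans (Eq.trans (by
    congr 3
    funext i
    exact Quotient.mk_out (s := jetSetoid n F E x) s x (mem_chart_source _ x)
      (mem_baseSet_trivializationAt F E x) i) (h0 s t).symm)
  have h2 := congrArg ((trivializationAt G V x).symmL ℝ x) h1
  unfold fib at h2
  rw [Trivialization.symmL_continuousLinearMapAt _ hb,
    Trivialization.symmL_continuousLinearMapAt _ hb] at h2
  exact h2

end Functions

section Operators

variable (n : ℕ) {M : Type*} [TopologicalSpace M] [ChartedSpace (Eu n) M] [IsManifold (𝓡 n) ∞ M]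
  (F : Type*) [NormedAddCommGroup F] [NormedSpace ℝ F]
  (E : M → Type*) [TopologicalSpace (TotalSpace F E)] [∀ x, AddCommGroup (E x)]
  [∀ x, Module ℝ (E x)] [∀ x, TopologicalSpace (E x)] [FiberBundle F E] [VectorBundle ℝ F E]
  (G : Type*) [NormedAddCommGroup G] [NormedSpace ℝ G]
  (V : M → Type*) [TopologicalSpace (TotalSpace G V)] [∀ x, AddCommGroup (V x)]
  [∀ x, Module ℝ (V x)] [∀ x, TopologicalSpace (V x)] [FiberBundle G V] [VectorBundle ℝ G V]

/-- The model fibre of the bundle of `n`-forms on an `n`-dimensional manifold. -/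
def TopModel : Type := Eu n [⋀^Fin n]→L[ℝ] ℝ

instance : NormedAddCommGroup (TopModel n) :=
  inferInstanceAs (NormedAddCommGroup (Eu n [⋀^Fin n]→L[ℝ] ℝ))

instance : NormedSpace ℝ (TopModel n) :=
  inferInstanceAs (NormedSpace ℝ (Eu n [⋀^Fin n]→L[ℝ] ℝ))

/-- The bundle `Λⁿ T^*M` of forms of top degree. -/
def Top (M : Type*) [TopologicalSpace M] [ChartedSpace (Eu n) M] [IsManifold (𝓡 n) ∞ M]
    (x : M) : Type := TangentSpace (𝓡 n) x [⋀^Fin n]→L[ℝ] (Bundle.Trivial M ℝ x)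

instance (x : M) : AddCommGroup (Top n M x) :=
  inferInstanceAs (AddCommGroup (TangentSpace (𝓡 n) x [⋀^Fin n]→L[ℝ] (Bundle.Trivial M ℝ x)))

instance (x : M) : Module ℝ (Top n M x) :=
  inferInstanceAs (Module ℝ (TangentSpace (𝓡 n) x [⋀^Fin n]→L[ℝ] (Bundle.Trivial M ℝ x)))

instance (x : M) : TopologicalSpace (Top n M x) :=
  inferInstanceAs (TopologicalSpace
    (TangentSpace (𝓡 n) x [⋀^Fin n]→L[ℝ] (Bundle.Trivial M ℝ x)))

instance (x : M) : IsTopologicalAddGroup (Top n M x) :=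
  inferInstanceAs (IsTopologicalAddGroup
    (TangentSpace (𝓡 n) x [⋀^Fin n]→L[ℝ] (Bundle.Trivial M ℝ x)))

instance (x : M) : ContinuousSMul ℝ (Top n M x) :=
  inferInstanceAs (ContinuousSMul ℝ
    (TangentSpace (𝓡 n) x [⋀^Fin n]→L[ℝ] (Bundle.Trivial M ℝ x)))

instance : TopologicalSpace (TotalSpace (TopModel n) (Top n M)) :=
  inferInstanceAs (TopologicalSpace (TotalSpace (Eu n [⋀^Fin n]→L[ℝ] ℝ)
    fun x : M => TangentSpace (𝓡 n) x [⋀^Fin n]→L[ℝ] (Bundle.Trivial M ℝ x)))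

instance : FiberBundle (TopModel n) (Top n M) :=
  inferInstanceAs (FiberBundle (Eu n [⋀^Fin n]→L[ℝ] ℝ)
    fun x : M => TangentSpace (𝓡 n) x [⋀^Fin n]→L[ℝ] (Bundle.Trivial M ℝ x))

instance : VectorBundle ℝ (TopModel n) (Top n M) :=
  inferInstanceAs (VectorBundle ℝ (Eu n [⋀^Fin n]→L[ℝ] ℝ)
    fun x : M => TangentSpace (𝓡 n) x [⋀^Fin n]→L[ℝ] (Bundle.Trivial M ℝ x))

/-- The model fibre of the bundle `V̂ = Hom(V, Λⁿ T^*M)`. -/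
abbrev HatModel (G : Type*) [NormedAddCommGroup G] [NormedSpace ℝ G] : Type _ := G →L[ℝ] TopModel n

/-- The bundle `V̂ = Hom(V, Λⁿ T^*M)`. -/
abbrev Hat (x : M) : Type _ := V x →L[ℝ] Top n M x

variable {n F E G V}
variable {G₁ : Type*} [NormedAddCommGroup G₁] [NormedSpace ℝ G₁]
  {V₁ : M → Type*} [TopologicalSpace (TotalSpace G₁ V₁)] [∀ x, AddCommGroup (V₁ x)]
  [∀ x, Module ℝ (V₁ x)] [∀ x, TopologicalSpace (V₁ x)] [FiberBundle G₁ V₁] [VectorBundle ℝ G₁ V₁]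
  {G₂ : Type*} [NormedAddCommGroup G₂] [NormedSpace ℝ G₂]
  {V₂ : M → Type*} [TopologicalSpace (TotalSpace G₂ V₂)] [∀ x, AddCommGroup (V₂ x)]
  [∀ x, Module ℝ (V₂ x)] [∀ x, TopologicalSpace (V₂ x)] [FiberBundle G₂ V₂] [VectorBundle ℝ G₂ V₂]

/-- The iterated partial derivative `∂_σ = ∂_{σ₁} ∘ ⋯ ∘ ∂_{σᵢ}`. -/
def pderiv {W : Type*} [NormedAddCommGroup W] [NormedSpace ℝ W] {i : ℕ} (σ : Fin i → Fin n)
    (h : Eu n → W) (y : Eu n) : W :=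
  iteratedFDeriv ℝ i h y fun j => EuclideanSpace.single (σ j) (1 : ℝ)

variable (n F G₁ G₂) in
/-- Coefficients `a^σ`, `|σ| ≤ l`, of a matrix total derivative operator of order at most `l` in a
coordinate system; they are functions of `t`, `x` and of the derivatives up to order `k`. -/
abbrev Coeff (l k : ℕ) : Type _ :=
  (i : Fin (l + 1)) → (Fin i → Fin n) → ℝ × Eu n × JetCoord n F k → (G₁ →L[ℝ] G₂)

/-- In the coordinate system around `x₀`, the operator `Δ` is `∑_σ a^σ D_σ` with smooth `a^σ`. Here
`D_σ` is the total derivative: the restriction of `D_σ p` to the infinite jet of a section `s` is the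
derivative `∂_σ` of the restriction of `p`. -/
def HasCoeff (x₀ : M) {l k : ℕ} (Δ : Gam n F E G₁ V₁ → Gam n F E G₂ V₂)
    (a : Coeff n F G₁ G₂ l k) : Prop :=
  (∀ i σ, ContDiff ℝ ∞ (a i σ)) ∧ ∀ᶠ x in 𝓝 x₀, ∀ (p : Gam n F E G₁ V₁) (s : Sec n F E) (t : ℝ),
    fib G₂ V₂ x₀ x ((Δ p).1 (pt x s t)) = ∑ i, ∑ σ,
      a i σ (t, chartAt (Eu n) x₀ x, jetOf n F k (localRep n F E x₀ s) (chartAt (Eu n) x₀ x))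
        (pderiv σ (localRep n G₁ V₁ x₀ fun x' => p.1 (pt x' s t)) (chartAt (Eu n) x₀ x))

/-- `Δ` is a `𝒞`-differential operator of order at most `l`. -/
def IsCDiffOfOrder (l : ℕ) (Δ : Gam n F E G₁ V₁ → Gam n F E G₂ V₂) : Prop :=
  ∃ k, ∀ x₀ : M, ∃ a : Coeff n F G₁ G₂ l k, HasCoeff x₀ Δ a

/-- `Δ` is a `𝒞`-differential operator. -/
def IsCDiff (Δ : Gam n F E G₁ V₁ → Gam n F E G₂ V₂) : Prop := ∃ l, IsCDiffOfOrder l Δ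

/-- The order of a `𝒞`-differential operator. -/
def ord (Δ : Gam n F E G₁ V₁ → Gam n F E G₂ V₂) : ℕ := sInf {l | IsCDiffOfOrder l Δ}

/-- `A` is a multidifferential operator: it is a `𝒞`-differential operator in each argument, of an
order that is bounded over all choices of the other arguments. -/
def IsMultiCDiff {r : ℕ} (A : (Fin r → Gam n F E G₁ V₁) → Gam n F E G₂ V₂) : Prop :=
  ∃ l, ∀ (i : Fin r) (ξ : Fin r → Gam n F E G₁ V₁),
    IsCDiffOfOrder l fun p => A (Function.update ξ i p)

/-- The operator `δ_a(Δ) = a Δ - Δ ∘ a`, for a smooth function `a` on `M`. -/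
def delta (a : C^∞⟮𝓡 n, M; 𝓘(ℝ), ℝ⟯) (Δ : Gam n F E G₁ V₁ → Gam n F E G₂ V₂) :
    Gam n F E G₁ V₁ → Gam n F E G₂ V₂ :=
  fun p => smulBase a (Δ p) - Δ (smulBase a p)

/-- The symbol of `Δ`, of order `l`, is nonsingular at `ρ`: its value on the symmetric form `(da)^l`,
`p ↦ (δ_a)^l(Δ)(p)`, is an isomorphism of the fibres over `ρ` for some function `a` on `M`.
Equivalently, the determinant of the symbol at `ρ` is a nonzero polynomial on `T_x^*M`. -/
def SymbolNonsingularAt (l : ℕ) (Δ : Gam n F E G₁ V₁ → Gam n F E G₂ V₂) (ρ : EInf n F E) : Prop :=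
  ∃ (a : C^∞⟮𝓡 n, M; 𝓘(ℝ), ℝ⟯) (L : V₁ ρ.base ≃ₗ[ℝ] V₂ ρ.base),
    ∀ p : Gam n F E G₁ V₁, ((delta a)^[l] Δ p).1 ρ = L (p.1 ρ)

/-- `Δ'` is the adjoint `V̂₂ → V̂₁` of the `𝒞`-differential operator `Δ : V₁ → V₂`: in coordinates,
`(∑_σ a^σ D_σ)^* = ∑_σ (-1)^{|σ|} D_σ ∘ (a^σ)^T`. -/
def IsAdjoint (Δ : Gam n F E G₁ V₁ → Gam n F E G₂ V₂)
    (Δ' : Gam n F E (HatModel n G₂) (Hat n V₂) → Gam n F E (HatModel n G₁) (Hat n V₁)) : Prop :=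
  IsCDiff Δ ∧ ∀ (x₀ : M) (l k : ℕ) (a : Coeff n F G₁ G₂ l k), HasCoeff x₀ Δ a →
    ∀ᶠ x in 𝓝 x₀, ∀ (q : Gam n F E (HatModel n G₂) (Hat n V₂)) (s : Sec n F E) (t : ℝ),
      fib (HatModel n G₁) (Hat n V₁) x₀ x ((Δ' q).1 (pt x s t)) = ∑ i : Fin (l + 1), ∑ σ,
        (-1 : ℝ) ^ (i : ℕ) • pderiv σ (fun y =>
          (localRep n (HatModel n G₂) (Hat n V₂) x₀ (fun x' => q.1 (pt x' s t)) y).comp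
            (a i σ (t, y, jetOf n F k (localRep n F E x₀ s) y))) (chartAt (Eu n) x₀ x)

/-- The equation `∇(A(ξ₁, …, ξ_r)) + ∑ᵢ A(ξ₁, …, ∇'(ξᵢ), …, ξ_r) = 0`. -/
def InvarianceEq {P Q : Type*} [AddCommGroup Q] {r : ℕ} (N : Q → Q) (N' : P → P)
    (A : (Fin r → P) → Q) : Prop :=
  ∀ ξ : Fin r → P, N (A ξ) + ∑ i, A (Function.update ξ i (N' (ξ i))) = 0

/-- The vanishing of the Lie derivative of `A`, for Lie derivatives `L` on the values and `L'` on the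
arguments: `L(A(ξ₁, …, ξ_r)) - ∑ᵢ A(ξ₁, …, L'(ξᵢ), …, ξ_r) = 0`. -/
def LieInvariant {P Q : Type*} [AddCommGroup Q] {r : ℕ} (L : Q → Q) (L' : P → P)
    (A : (Fin r → P) → Q) : Prop :=
  ∀ ξ : Fin r → P, L (A ξ) - ∑ i, A (Function.update ξ i (L' (ξ i))) = 0

/-- `A` is skew-symmetric. -/
def IsSkew {P Q : Type*} [AddCommGroup Q] {r : ℕ} (A : (Fin r → P) → Q) : Prop :=
  ∀ (τ : Equiv.Perm (Fin r)) (ξ : Fin r → P), A (ξ ∘ τ) = (Equiv.Perm.sign τ : ℤ) • A ξ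

theorem fib_hom {W : M → Type*} {K : Type*}  [NormedAddCommGroup K] [NormedSpace ℝ K]
  [TopologicalSpace (TotalSpace K W)] [∀ x, AddCommGroup (W x)]
  [∀ x, Module ℝ (W x)] [∀ x, TopologicalSpace (W x)] [FiberBundle K W] [VectorBundle ℝ K W]
   [∀ x, IsTopologicalAddGroup (W x)] [∀ x, ContinuousSMul ℝ (W x)]
  {x₀ x : M} (hx : x ∈ (trivializationAt G V x₀).baseSet)
    (hx' : x ∈ (trivializationAt K W x₀).baseSet) (q : V x →L[ℝ] W x) :
    fib (G →L[ℝ] K) (fun x => V x →L[ℝ] W x) x₀ x q =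
      ((fib K W x₀ x).comp q).comp ((trivializationAt G V x₀).symmL ℝ x) := by
  have h : x ∈ (trivializationAt (G →L[ℝ] K) (fun x => V x →L[ℝ] W x) x₀).baseSet := ⟨hx, hx'⟩
  unfold fib
  ext1 w
  refine (congrArg (fun L : G →L[ℝ] K => L w) (Trivialization.continuousLinearMapAt_apply_of_mem ℝ _
    h q)).trans ?_
  rfl
theorem fib_hat {x₀ x : M} (hx : x ∈ (trivializationAt G V x₀).baseSet)
    (hx' : x ∈ (trivializationAt (TopModel n) (Top n M) x₀).baseSet) (q : Hat n V x) :
    fib (HatModel n G) (Hat n V) x₀ x q =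
      ((fib (TopModel n) (Top n M) x₀ x).comp q).comp ((trivializationAt G V x₀).symmL ℝ x) := 
  fib_hom hx hx' q
section BiDual

variable [∀ x, IsTopologicalAddGroup (V x)] [∀ x, ContinuousSMul ℝ (V x)]

/-- The evaluation map `V_x → Hom(Hom(V_x, Λⁿ), Λⁿ)`. -/
def evalHat (x : M) (v : V x) : Hat n (Hat n V) x :=
  ⟨{ toFun := fun q => q v, map_add' := fun _ _ => rfl, map_smul' := fun _ _ => rfl },
    continuous_eval_const v⟩

theorem fib_eval {W : M → Type*} {K : Type*} [NormedAddCommGroup K] [NormedSpace ℝ K]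
    [TopologicalSpace (TotalSpace K W)] [∀ x, AddCommGroup (W x)]
    [∀ x, Module ℝ (W x)] [∀ x, TopologicalSpace (W x)] [FiberBundle K W] [VectorBundle ℝ K W]
    [∀ x, IsTopologicalAddGroup (W x)] [∀ x, ContinuousSMul ℝ (W x)]
    {x₀ x : M} (hx : x ∈ (trivializationAt G V x₀).baseSet)
    (hx' : x ∈ (trivializationAt K W x₀).baseSet) (v : V x)
    (ev : (V x →L[ℝ] W x) →L[ℝ] W x) (hev : ∀ q, ev q = q v) :
    fib ((G →L[ℝ] K) →L[ℝ] K) (fun x => (V x →L[ℝ] W x) →L[ℝ] W x) x₀ x ev =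
      ContinuousLinearMap.apply ℝ K (fib G V x₀ x v) := by
  have hb : x ∈ (trivializationAt (G →L[ℝ] K) (fun x => V x →L[ℝ] W x) x₀).baseSet := ⟨hx, hx'⟩
  have e1 := fib_hom (V := fun x => V x →L[ℝ] W x) (W := W) hb hx' ev
  refine e1.trans ?_
  ext1 w
  set q := (trivializationAt (G →L[ℝ] K) (fun x => V x →L[ℝ] W x) x₀).symmL ℝ x w with hq
  have e3 : fib (G →L[ℝ] K) (fun x => V x →L[ℝ] W x) x₀ x q = w :=
    (trivializationAt (G →L[ℝ] K) (fun x => V x →L[ℝ] W x) x₀).continuousLinearMapAt_symmL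
      (R := ℝ) hb w
  have e4 := (fib_hom hx hx' q).symm.trans e3
  have e5 := congrArg (fun L : G →L[ℝ] K => L (fib G V x₀ x v)) e4
  have e6 : (trivializationAt G V x₀).symmL ℝ x (fib G V x₀ x v) = v :=
    (trivializationAt G V x₀).symmL_continuousLinearMapAt (R := ℝ) hx v
  refine Eq.trans ?_ e5
  change fib K W x₀ x (ev q) = fib K W x₀ x (q ((trivializationAt G V x₀).symmL ℝ x (fib G V x₀ x v)))
  rw [hev, e6]

theorem fib_evalHat {x₀ x : M} (hx : x ∈ (trivializationAt G V x₀).baseSet)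
    (hx' : x ∈ (trivializationAt (TopModel n) (Top n M) x₀).baseSet) (v : V x) :
    fib (HatModel n (HatModel n G)) (Hat n (Hat n V)) x₀ x (evalHat x v) =
      ContinuousLinearMap.apply ℝ (TopModel n) (fib G V x₀ x v) :=
  fib_eval hx hx' v _ fun _ => rfl

/-- The canonical identification of a section of `V` with a section of the double dual of `V`. -/
def bidual (v : Gam n F E G V) :
    Gam n F E (HatModel n (HatModel n G)) (Hat n (Hat n V)) :=
  ⟨fun ρ => evalHat ρ.base (v.1 ρ), by
    obtain ⟨v, k, hv⟩ := v
    refine ⟨k, fun x₀ => ?_⟩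
    obtain ⟨g, hg, h⟩ := hv x₀
    refine ⟨fun z => ContinuousLinearMap.apply ℝ (TopModel n) (g z),
      (ContinuousLinearMap.contDiff _).comp hg, ?_⟩
    filter_upwards [h,
      (trivializationAt G V x₀).open_baseSet.mem_nhds (mem_baseSet_trivializationAt G V x₀),
      (trivializationAt (TopModel n) (Top n M) x₀).open_baseSet.mem_nhds
        (mem_baseSet_trivializationAt (TopModel n) (Top n M) x₀)] with x hx hb hb' s t
    rw [← hx s t]
    exact fib_evalHat hb hb' _⟩

end BiDual

variable [ContMDiffVectorBundle ∞ F E (𝓡 n)]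

/-- The total derivative `D_t = ∂/∂t + Э_f` of the equation `u_t = f`. -/
def totalT (f : Gam n F E F E) (p : Gam n F E G V) : Gam n F E G V := timeDeriv p + lin p f

variable (n F E) in
/-- The module `κ` of variational vectors on `ℰ^∞`, the sections of the pullback of `π`. -/
abbrev Kappa : Type _ := Gam n F E F E

variable (n F E) in
/-- The module `κ̂`. -/
abbrev KappaHat : Type _ := Gam n F E (HatModel n F) (Hat n E)

/-- The linearization `ℓ_ℰ = D_t - ℓ_f : κ → κ` of the equation `u_t = f`; it is also the Lie
derivative along `D_t` on `κ`. -/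
def linEq (f : Kappa n F E) (α : Kappa n F E) : Kappa n F E := totalT f α - lin f α

/-- The adjoint linearization `ℓ_ℰ^* = -D_t - ℓ_f^* : κ̂ → κ̂`, where `adj` is `ℓ_f^*`. -/
def adjLinEq (f : Kappa n F E) (adj : KappaHat n F E → KappaHat n F E) (q : KappaHat n F E) :
    KappaHat n F E := -totalT f q - adj q

/-- The Lie derivative `D_t + ℓ_f^*` along `D_t` on `κ̂`, where `adj` is `ℓ_f^*`. -/
def lieHat (f : Kappa n F E) (adj : KappaHat n F E → KappaHat n F E) (q : KappaHat n F E) :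
    KappaHat n F E := totalT f q + adj q

section Variational

variable [∀ x, IsTopologicalAddGroup (E x)] [∀ x, ContinuousSMul ℝ (E x)]

/-- `A` is a variational `k`-vector on the equation `u_t = f`: a multidifferential operator
`κ̂ × ⋯ × κ̂ → κ` (`k - 1` arguments) that is skew-symmetric, skew-adjoint in each argument (under the
identification of `κ` with the double dual) and invariant. -/
structure IsVariationalVector (f : Kappa n F E) (adj : KappaHat n F E → KappaHat n F E) (k : ℕ)
    (A : (Fin (k - 1) → KappaHat n F E) → Kappa n F E) : Prop where
  multi : IsMultiCDiff A
  skew : IsSkew A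
  skewAdjoint : ∀ i ξ, IsAdjoint (fun q => A (Function.update ξ i q))
    (fun q => -bidual (A (Function.update ξ i q)))
  invariant : LieInvariant (linEq f) (lieHat f adj) A

/-- `A` is a variational `k`-form on the equation `u_t = f`: a multidifferential operator
`κ × ⋯ × κ → κ̂` (`k - 1` arguments) that is skew-symmetric, skew-adjoint in each argument (under the
identification of `κ` with the double dual) and invariant. -/
structure IsVariationalForm (f : Kappa n F E) (adj : KappaHat n F E → KappaHat n F E) (k : ℕ)
    (A : (Fin (k - 1) → Kappa n F E) → KappaHat n F E) : Prop where
  multi : IsMultiCDiff A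
  skew : IsSkew A
  skewAdjoint : ∀ i ξ, ∃ Δ' : Gam n F E (HatModel n (HatModel n F)) (Hat n (Hat n E)) → KappaHat n F E,
    IsAdjoint (fun α => A (Function.update ξ i α)) Δ' ∧
      ∀ α, Δ' (bidual α) = -A (Function.update ξ i α)
  invariant : LieInvariant (lieHat f adj) (linEq f) A

end Variational

end Operators
end EvolEq
end

/-!
The proof is a study of the top symbol of `A`, by commutators with functions on `M`.

For a function `a` on `M`, let `δ_a(Δ) = a Δ - Δ a`, and let `δ_{a,i}` be the analogous operation
on the `i`-th argument of a multidifferential operator. An operator of order `l` is annihilated by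
`l + 1` such commutators, and `l` of them give its symbol. The total derivative `D_t` commutes with
the functions on `M` (`fnDelta_totalTLin`), so that it drops out of all commutators, and `ℓ_ℰ` and
`ℓ_ℰ^*` behave like `-ℓ_f` and `-ℓ_f^*`, operators of order `l = ord ℓ_f` whose symbols are, at
each point, transposed to each other up to sign (`IsAdjoint.exists_symbol`). Write the invariance
equation as `Φ(A) = 0` with `Φ` the operator `B ↦ ∇ ∘ B + ∑ᵢ B(…, ∇^*(ξᵢ), …)` (`invOp`). As the
order of `A` in each argument is bounded, products of sufficiently many of the `δ_{a,i}` annihilate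
`A` (`word_eq_zero_of_slots`). Suppose that products of `d + 1` factors do; the claim is that
products of `d` factors do as well, and then `A = 0` by induction.

Fix a point of the dense set and a function `a` whose covector `θ` there makes the symbol of `ℓ_f`
invertible. Let the covectors attached to two different arguments be multiples `x θ` and `y θ`, and
apply `d + l` commutators to `Φ(A) = 0`. By the Leibniz rule (`divPow_mul`), this is the equation
`Φ_l(x, y) A_d(x, y) = 0` between the homogeneous polynomials in `x` and `y` that the top
commutators of `Φ` and of `A` form. The composition with the symbol of `∇` contributes `(x + y)^l`
times this symbol to `Φ_l`, while the symbol of `∇^*` in one argument contributes multiples of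
`x^l` or of `y^l` only. As `l ≥ 2`, there is a mixed monomial `x^(l-1) y`, and its coefficient in
`Φ_l` is `l` times the composition with the symbol of `∇`, which is injective. All coefficients of
`Φ_l` commute (`commute_invOp`), so McCoy's theorem on zero divisors among polynomials
(`mem_of_convolution_mem`) shows that `A_d(x, y) = 0` (`divPow_mul_divPow_mem`). The same argument
applies after the remaining commutators, with arbitrary functions in arbitrary arguments, have been
moved across `Φ` (`move_word_mem`); an induction on their number takes care of all products of `d`
factors (`word_mem_valuesIn`). The two arguments exist since `k ≥ 3`.

All of this takes place at a point, that is, modulo the sections that vanish there. A section that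
vanishes on a dense subset is zero (`eq_zero_of_dense`). For operators with values in `κ̂` the
relevant symbol is that of `ℓ_f^*`, the composition with the symbol of `ℓ_f`; it is injective as
the latter is onto, because sections take all values at a point (`exists_gam_apply_eq`). The
statements on variational vectors and forms are special cases, their invariance being the same
equation up to sign.
-/

set_option linter.unusedSectionVars false
set_option synthInstance.maxHeartbeats 200000

namespace EvolEq

/-! ### Divided powers and commutators -/

section Commutators

variable {K : Type*} [Field K]

/-- The divided power `x ^ m / m!`. -/
def divPow (K : Type*) [Field K] {R : Type*} [Ring R] [Algebra K R] (x : R) (m : ℕ) : R :=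
  ((m.factorial : K)⁻¹) • x ^ m

theorem divPow_add [CharZero K] {R : Type*} [Ring R] [Algebra K R] {x y : R} (h : Commute x y)
    (m : ℕ) : divPow K (x + y) m =
      ∑ ij ∈ Finset.HasAntidiagonal.antidiagonal m, divPow K x ij.1 * divPow K y ij.2 := by
  unfold divPow
  rw [h.add_pow', Finset.smul_sum]
  refine Finset.sum_congr rfl fun ij hij => ?_
  have hm : ij.1 + ij.2 = m := Finset.HasAntidiagonal.mem_antidiagonal.1 hij
  rw [smul_mul_smul_comm, ← Nat.cast_smul_eq_nsmul K, smul_smul]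
  congr 1
  have h1 : ((ij.1.factorial : ℕ) : K) ≠ 0 := Nat.cast_ne_zero.2 (Nat.factorial_ne_zero _)
  have h2 : ((ij.2.factorial : ℕ) : K) ≠ 0 := Nat.cast_ne_zero.2 (Nat.factorial_ne_zero _)
  have h3 : ((m.factorial : ℕ) : K) ≠ 0 := Nat.cast_ne_zero.2 (Nat.factorial_ne_zero _)
  have h4 := Nat.add_choose_mul_factorial_mul_factorial ij.1 ij.2
  rw [← Nat.choose_symm_add, hm] at h4
  have h5 : (m.choose ij.1 : K) * ij.1.factorial * ij.2.factorial = m.factorial := by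
    exact_mod_cast h4
  field_simp
  linear_combination h5

/-- The commutator with `x`, as a linear map. -/
def comm (K : Type*) [Field K] {R : Type*} [Ring R] [Algebra K R] (x : R) : R →ₗ[K] R :=
  LinearMap.mulLeft K x - LinearMap.mulRight K x

theorem comm_apply {R : Type*} [Ring R] [Algebra K R] (x y : R) :
    comm K x y = x * y - y * x := rfl

/-- The Leibniz rule for divided powers. -/
theorem divPow_mul [CharZero K] {R : Type*} [Ring R] [Algebra K R] (x y : R) (m : ℕ) :
    divPow K x m * y = ∑ ij ∈ Finset.HasAntidiagonal.antidiagonal m,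
      divPow K (comm K x) ij.1 y * divPow K x ij.2 := by
  have hc : Commute (comm K x) (LinearMap.mulRight K x) :=
    (LinearMap.commute_mulLeft_right (R := K) x x).sub_left (Commute.refl _)
  have h := congrArg (fun T : Module.End K R => T y) (divPow_add (K := K) hc m)
  have h0 : comm K x + LinearMap.mulRight K x = LinearMap.mulLeft K x := sub_add_cancel _ _
  rw [h0] at h
  simp only [divPow, LinearMap.smul_apply, LinearMap.pow_mulLeft, LinearMap.mulLeft_apply,
    LinearMap.sum_apply, Module.End.mul_apply, LinearMap.pow_mulRight, LinearMap.mulRight_apply] at h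
  simp only [divPow, smul_mul_assoc, LinearMap.smul_apply]
  rw [h]
  refine Finset.sum_congr rfl fun ij _ => ?_
  have h1 := congrArg (fun T : Module.End K R => T y) (hc.pow_pow ij.1 ij.2).eq
  simp only [Module.End.mul_apply, LinearMap.pow_mulRight, LinearMap.mulRight_apply] at h1
  rw [map_smul, h1, mul_smul_comm]

/-- `x` is an operator of order at most `s` with respect to the commutator-like maps `δ i`, and
its symbols, the `s`-fold iterates of the maps `δ i` on `x`, satisfy `R`. -/
def HasOrder {I X : Type*} [Zero X] (δ : I → X → X) (R : X → Prop) : ℕ → X → Prop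
  | 0, x => R x ∧ ∀ i, δ i x = 0
  | s + 1, x => ∀ i, HasOrder δ R s (δ i x)

theorem HasOrder.iterate {I X : Type*} [Zero X] {δ : I → X → X} {R : X → Prop} (i : I) {s : ℕ}
    {x : X} (h : HasOrder δ R s x) : HasOrder δ R 0 ((δ i)^[s] x) := by
  induction s generalizing x with
  | zero => exact h
  | succ s ih => exact ih (h i)

/-- The product of the operators `D i` over the letters `i` of a word. -/
def word {I R : Type*} [Monoid R] (D : I → R) (w : List I) : R := (w.map D).prod

section Word

variable {I R : Type*} [Monoid R] {D : I → R}

theorem word_cons (i : I) (w : List I) : word D (i :: w) = D i * word D w := List.prod_cons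

theorem word_append (w w' : List I) : word D (w ++ w') = word D w * word D w' := by
  simp [word]

theorem word_replicate (m : ℕ) (i : I) : word D (List.replicate m i) = D i ^ m := by
  simp [word]

theorem commute_word (hD : ∀ i j, Commute (D i) (D j)) (i : I) (w : List I) :
    Commute (D i) (word D w) :=
  Commute.list_prod_right _ _ fun x hx => by
    obtain ⟨j, _, rfl⟩ := List.mem_map.1 hx
    exact hD i j

theorem commute_word_word (hD : ∀ i j, Commute (D i) (D j)) (w w' : List I) :
    Commute (word D w) (word D w') :=
  Commute.list_prod_left _ _ fun x hx => by
    obtain ⟨j, _, rfl⟩ := List.mem_map.1 hx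
    exact commute_word hD j w'

end Word

variable {V : Type*} [AddCommGroup V] [Module K V]

/-- If the words of length `m` annihilate `A`, so do the longer ones. -/
theorem word_eq_zero_of_le {I : Type*} {D : I → Module.End K V} {A : V} {m : ℕ}
    (h : ∀ w : List I, w.length = m → word D w A = 0) (w : List I) (hw : m ≤ w.length) :
    word D w A = 0 := by
  rw [← List.take_append_drop (w.length - m) w, word_append, Module.End.mul_apply, h, map_zero]
  rw [List.length_drop]
  omega

/-- If `Ψ` has order at most `s`, then applying a word of length `m` to `Ψ B` reduces, modulo `Z`,
to the words of length `m - s` applied to `B`. -/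
theorem word_apply_mem {I : Type*} {D : I → Module.End K V} (hD : ∀ i j, Commute (D i) (D j))
    (Z : Submodule K V) (w : List I) : ∀ (s : ℕ) (Ψ : Module.End K V) (B : V),
    HasOrder (fun i => comm K (D i)) (fun Ψ => ∀ v ∈ Z, Ψ v ∈ Z) s Ψ →
    (∀ w', w'.Sublist w → w'.length + s = w.length → word D w' B ∈ Z) →
    (∀ w', w'.Sublist w → w.length < w'.length + s → word D w' B = 0) →
    word D w (Ψ B) ∈ Z := by
  induction w with
  | nil =>
    intro s Ψ B hΨ h1 h2
    cases s with
    | zero => exact hΨ.1 _ (h1 [] (List.Sublist.refl _) rfl)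
    | succ s =>
      have : B = 0 := h2 [] (List.Sublist.refl _) (by simp)
      subst this
      rw [map_zero, map_zero]
      exact Z.zero_mem
  | cons b w ih =>
    intro s Ψ B hΨ h1 h2
    have e0 : word D (b :: w) (Ψ B) = word D w (Ψ (D b B)) + word D w (comm K (D b) Ψ B) := by
      rw [word_cons, (commute_word hD b w).eq, Module.End.mul_apply, ← map_add, comm_apply]
      congr 1
      simp
    have e1 : ∀ w', word D w' (D b B) = word D (b :: w') B := fun w' => by
      rw [word_cons, (commute_word hD b w').eq, Module.End.mul_apply]
    rw [e0]
    refine Z.add_mem (ih s Ψ (D b B) hΨ (fun w' hw hl => ?_) (fun w' hw hl => ?_)) ?_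
    · rw [e1]
      exact h1 _ (hw.cons_cons b) (by simp only [List.length_cons]; omega)
    · rw [e1]
      exact h2 _ (hw.cons_cons b) (by simp only [List.length_cons]; omega)
    · cases s with
      | zero =>
        have : comm K (D b) Ψ = 0 := hΨ.2 b
        rw [this, LinearMap.zero_apply, map_zero]
        exact Z.zero_mem
      | succ s =>
        refine ih s _ B (hΨ b) (fun w' hw hl => ?_) (fun w' hw hl => ?_)
        · exact h1 _ (hw.cons b) (by simp only [List.length_cons]; omega)
        · exact h2 _ (hw.cons b) (by simp only [List.length_cons]; omega)

/-- A module version of McCoy's theorem: a polynomial `∑ tᵢ Xⁱ` whose coefficients are commuting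
operators, one of which is injective, is not a zero divisor on polynomials `∑ y_q X^q`. Everything
is relative to a submodule `Z` preserved by the operators. -/
theorem mem_of_convolution_mem (Z : Submodule K V) (t : ℕ → Module.End K V)
    (ht : ∀ i j, Commute (t i) (t j)) (hZ : ∀ i, ∀ v ∈ Z, t i v ∈ Z) {i₀ : ℕ}
    (hi₀ : ∀ v, t i₀ v ∈ Z → v ∈ Z) (e l : ℕ) (y : ℕ → V) (hy : ∀ q, e ≤ q → y q ∈ Z)
    (hl : i₀ ≤ l) (h : ∀ m, ∑ ij ∈ Finset.HasAntidiagonal.antidiagonal m,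
      (if ij.1 ≤ l then t ij.1 (y ij.2) else 0) ∈ Z) (q : ℕ) : y q ∈ Z := by
  -- the product of the top coefficients is the top coefficient of the product
  have top : ∀ (e l : ℕ) (y : ℕ → V), (∀ q, e + 1 ≤ q → y q ∈ Z) →
      (∀ m, ∑ ij ∈ Finset.HasAntidiagonal.antidiagonal m,
        (if ij.1 ≤ l then t ij.1 (y ij.2) else 0) ∈ Z) → t l (y e) ∈ Z := by
    intro e l y hy h
    have hm : ((l, e) : ℕ × ℕ) ∈ Finset.HasAntidiagonal.antidiagonal (l + e) :=
      Finset.HasAntidiagonal.mem_antidiagonal.2 rfl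
    have h1 := h (l + e)
    rw [← Finset.add_sum_erase _ _ hm, if_pos le_rfl] at h1
    refine (Z.add_mem_iff_left (Z.sum_mem fun ij hij => ?_)).1 h1
    obtain ⟨hne, hij⟩ := Finset.mem_erase.1 hij
    have hs : ij.1 + ij.2 = l + e := Finset.HasAntidiagonal.mem_antidiagonal.1 hij
    split_ifs with hle
    · refine hZ _ _ (hy _ ?_)
      by_contra hlt
      exact hne (Prod.ext (by dsimp only; omega) (by dsimp only; omega))
    · exact Z.zero_mem
  -- induction on the degree `e` of `y` and, for fixed `e`, on the degree `l` of `t`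
  induction e generalizing y l q with
  | zero => exact hy q (Nat.zero_le q)
  | succ e ihe =>
    induction l, hl using Nat.le_induction with
    | base =>
      refine ihe i₀ y (fun q hq => ?_) le_rfl h q
      rcases hq.eq_or_lt with rfl | hq
      · exact hi₀ _ (top _ _ y hy h)
      · exact hy q hq
    | succ l hl ihl =>
      -- the top coefficient `t (l + 1)` kills the top coefficient of `y`, so `t (l + 1) y` has
      -- smaller degree; as it also solves the equation, it vanishes, and `t (l + 1)` can be dropped
      have h1 : ∀ q, t (l + 1) (y q) ∈ Z := by
        refine fun q => ihe (l + 1) (fun q => t (l + 1) (y q)) (fun q hq => ?_) (by omega)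
          (fun m => ?_) q
        · rcases hq.eq_or_lt with rfl | hq
          · exact top _ _ y hy h
          · exact hZ _ _ (hy q hq)
        · have h2 := hZ (l + 1) _ (h m)
          rw [map_sum] at h2
          convert h2 using 2 with ij
          rw [apply_ite (t (l + 1)), map_zero]
          congr 1
          exact congrArg (fun T : Module.End K V => T (y ij.2)) (ht ij.1 (l + 1)).eq
      refine ihl fun m => ?_
      rw [← Z.add_mem_iff_left (y := ∑ ij ∈ Finset.HasAntidiagonal.antidiagonal m,
        (if ij.1 = l + 1 then t ij.1 (y ij.2) else 0)), ← Finset.sum_add_distrib]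
      · convert h m using 2 with ij
        rcases lt_trichotomy ij.1 (l + 1) with h3 | h3 | h3
        · rw [if_pos (by omega), if_neg (by omega), if_pos (by omega), add_zero]
        · rw [if_neg (by omega), if_pos h3, if_pos (by omega), zero_add]
        · rw [if_neg (by omega), if_neg (by omega), if_neg (by omega), add_zero]
      · refine Z.sum_mem fun ij _ => ?_
        split_ifs with h3
        · rw [h3]
          exact h1 _
        · exact Z.zero_mem

end Commutators

/-! ### Multilinear operators and the invariance equation -/

section Multilinear

variable {K : Type*} [Field K] {P Q : Type*} [AddCommGroup P] [Module K P] [AddCommGroup Q]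
  [Module K Q] {C : Type*}

/-- The commutator `δ_c(Δ) = ν_c Δ - Δ μ_c` of an operator `Δ : P → Q` with the actions `μ` and
`ν` of the elements `c` on `P` and on `Q`. -/
def opDelta (μ : C → Module.End K P) (ν : C → Module.End K Q) (c : C) (Δ : P →ₗ[K] Q) : P →ₗ[K] Q :=
  ν c ∘ₗ Δ - Δ ∘ₗ μ c

theorem opDelta_zero (μ : C → Module.End K P) (ν : C → Module.End K Q) (c : C) :
    opDelta μ ν c 0 = 0 := by
  simp [opDelta]

theorem opDelta_add (μ : C → Module.End K P) (ν : C → Module.End K Q) (c : C)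
    (Δ Δ' : P →ₗ[K] Q) : opDelta μ ν c (Δ + Δ') = opDelta μ ν c Δ + opDelta μ ν c Δ' := by
  simp only [opDelta, LinearMap.comp_add, LinearMap.add_comp]
  abel

theorem opDelta_smul (μ : C → Module.End K P) (ν : C → Module.End K Q) (c : C) (a : K)
    (Δ : P →ₗ[K] Q) : opDelta μ ν c (a • Δ) = a • opDelta μ ν c Δ := by
  simp only [opDelta, LinearMap.comp_smul, LinearMap.smul_comp, smul_sub]

theorem opDelta_iterate_neg (μ : C → Module.End K P) (ν : C → Module.End K Q) (c : C) (m : ℕ)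
    (Δ : P →ₗ[K] Q) : (opDelta μ ν c)^[m] (-Δ) = -(opDelta μ ν c)^[m] Δ := by
  induction m generalizing Δ with
  | zero => rfl
  | succ m ih =>
    rw [Function.iterate_succ_apply, Function.iterate_succ_apply, ← ih, ← neg_one_smul K Δ,
      opDelta_smul, neg_one_smul]

variable {ι : Type*} [DecidableEq ι]

theorem update_id_apply (i : ι) (N : Module.End K P) (ξ : ι → P) :
    (fun j => (Function.update (fun _ => LinearMap.id) i N : ι → P →ₗ[K] P) j (ξ j)) =
      Function.update ξ i (N (ξ i)) := by
  funext j
  by_cases h : j = i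
  · subst h; simp
  · simp [h]

/-- The map `B ↦ N ∘ B` on multilinear operators. -/
def postcomp (ι P : Type*) [AddCommGroup P] [Module K P] :
    Module.End K Q →ₗ[K] Module.End K (MultilinearMap K (fun _ : ι => P) Q) where
  toFun N :=
    { toFun := fun B => N.compMultilinearMap B
      map_add' := fun B B' => by ext; simp
      map_smul' := fun a B => by ext; simp }
  map_add' N N' := by ext; simp
  map_smul' a N := by ext; simp

/-- The map `B ↦ B(…, N(ξᵢ), …)` on multilinear operators. -/
def precomp (Q : Type*) [AddCommGroup Q] [Module K Q] (i : ι) :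
    Module.End K P →ₗ[K] Module.End K (MultilinearMap K (fun _ : ι => P) Q) where
  toFun N :=
    { toFun := fun B => B.compLinearMap (Function.update (fun _ => LinearMap.id) i N)
      map_add' := fun B B' => by ext; simp
      map_smul' := fun a B => by ext; simp }
  map_add' N N' := by
    ext B ξ
    refine (congrArg B (update_id_apply i (N + N') ξ)).trans ?_
    rw [LinearMap.add_apply, B.map_update_add, ← update_id_apply, ← update_id_apply]
    rfl
  map_smul' a N := by
    ext B ξ
    refine (congrArg B (update_id_apply i (a • N) ξ)).trans ?_
    rw [LinearMap.smul_apply, B.map_update_smul, ← update_id_apply]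
    rfl

theorem postcomp_apply (N : Module.End K Q) (B : MultilinearMap K (fun _ : ι => P) Q) (ξ : ι → P) :
    postcomp ι P N B ξ = N (B ξ) := rfl

theorem precomp_apply (i : ι) (N : Module.End K P) (B : MultilinearMap K (fun _ : ι => P) Q)
    (ξ : ι → P) : precomp Q i N B ξ = B (Function.update ξ i (N (ξ i))) :=
  congrArg B (update_id_apply i N ξ)

theorem commute_postcomp_precomp (N : Module.End K Q) (i : ι) (N' : Module.End K P) :
    Commute (postcomp ι P N) (precomp Q i N') := by
  ext B ξ
  simp only [Module.End.mul_apply, postcomp_apply, precomp_apply]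

theorem postcomp_mul (N N' : Module.End K Q) :
    postcomp ι P (N * N') = postcomp ι P N * postcomp ι P N' := rfl

theorem precomp_mul (i : ι) (N N' : Module.End K P) :
    precomp Q i N * precomp Q i N' = precomp Q i (N' * N) := by
  ext B ξ
  simp only [Module.End.mul_apply, precomp_apply, Function.update_idem, Function.update_self]

theorem commute_precomp {i j : ι} (h : i ≠ j) (N N' : Module.End K P) :
    Commute (precomp Q i N) (precomp Q j N') := by
  ext B ξ
  simp only [Module.End.mul_apply, precomp_apply, Function.update_of_ne h,
    Function.update_of_ne h.symm]
  rw [Function.update_comm h]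

/-- The operator `δ_{c,i}(B)(ξ) = c B(ξ) - B(…, c ξᵢ, …)` on multilinear operators. -/
def slotDelta (μ : C → Module.End K P) (ν : C → Module.End K Q) (x : ι × C) :
    Module.End K (MultilinearMap K (fun _ : ι => P) Q) :=
  postcomp ι P (ν x.2) - precomp Q x.1 (μ x.2)

theorem commute_slotDelta {μ : C → Module.End K P} {ν : C → Module.End K Q}
    (hμ : ∀ c c', Commute (μ c) (μ c')) (hν : ∀ c c', Commute (ν c) (ν c')) (x y : ι × C) :
    Commute (slotDelta μ ν x) (slotDelta μ ν y) := by
  have h1 : Commute (postcomp ι P (ν x.2)) (postcomp ι P (ν y.2)) := by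
    rw [Commute, SemiconjBy, ← postcomp_mul, (hν x.2 y.2).eq, postcomp_mul]
  have h2 : Commute (precomp Q x.1 (μ x.2)) (precomp Q y.1 (μ y.2)) := by
    by_cases h : x.1 = y.1
    · rw [h, Commute, SemiconjBy, precomp_mul, precomp_mul, (hμ x.2 y.2).eq]
    · exact commute_precomp h _ _
  exact (h1.sub_right (commute_postcomp_precomp _ _ _)).sub_left
    ((commute_postcomp_precomp _ _ _).symm.sub_right h2)

variable [Fintype ι]

/-- The operator `B ↦ N ∘ B + ∑ᵢ B(…, N'ᵢ(ξᵢ), …)` of the invariance equation. -/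
def invOp (N : Module.End K Q) (N' : ι → Module.End K P) :
    Module.End K (MultilinearMap K (fun _ : ι => P) Q) :=
  postcomp ι P N + ∑ i, precomp Q i (N' i)

theorem invOp_apply (N : Module.End K Q) (N' : ι → Module.End K P)
    (B : MultilinearMap K (fun _ : ι => P) Q) (ξ : ι → P) :
    invOp N N' B ξ = N (B ξ) + ∑ i, B (Function.update ξ i (N' i (ξ i))) := by
  simp only [invOp, LinearMap.add_apply, LinearMap.sum_apply, add_apply,
    sum_apply, precomp_apply, postcomp_apply]

theorem invOp_zero : invOp (0 : Module.End K Q) (0 : ι → Module.End K P) = 0 := by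
  simp [invOp]

theorem comm_slotDelta_invOp (μ : C → Module.End K P) (ν : C → Module.End K Q) (x : ι × C)
    (N : Module.End K Q) (N' : ι → Module.End K P) :
    comm K (slotDelta μ ν x) (invOp N N') =
      invOp (opDelta ν ν x.2 N) (Pi.single x.1 (opDelta μ μ x.2 (N' x.1))) := by
  have h1 : ∑ i, precomp Q i ((Pi.single x.1 (opDelta μ μ x.2 (N' x.1)) : ι → Module.End K P) i) =
      precomp Q x.1 (opDelta μ μ x.2 (N' x.1)) := by
    rw [Finset.sum_eq_single x.1 (fun i _ hi => by rw [Pi.single_eq_of_ne hi, map_zero])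
      (fun h => absurd (Finset.mem_univ _) h), Pi.single_eq_same]
  have h2 : comm K (precomp Q x.1 (μ x.2)) (∑ i, precomp Q i (N' i)) =
      - precomp Q x.1 (opDelta μ μ x.2 (N' x.1)) := by
    rw [map_sum, Finset.sum_eq_single x.1 (fun i _ hi => ?_)
      (fun h => absurd (Finset.mem_univ _) h)]
    · rw [comm_apply, precomp_mul, precomp_mul, ← map_sub, ← map_neg]
      congr 1
      exact (neg_sub _ _).symm
    · rw [comm_apply, (commute_precomp hi.symm _ _).eq, sub_self]
  have h3 : comm K (precomp Q x.1 (μ x.2)) (postcomp ι P N) = 0 := by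
    rw [comm_apply, (commute_postcomp_precomp _ _ _).eq, sub_self]
  have h4 : comm K (postcomp ι P (ν x.2)) (∑ i, precomp Q i (N' i)) = 0 := by
    rw [map_sum]
    refine Finset.sum_eq_zero fun i _ => ?_
    rw [comm_apply, (commute_postcomp_precomp _ _ _).eq, sub_self]
  have h5 : comm K (postcomp ι P (ν x.2)) (postcomp ι P N) = postcomp ι P (opDelta ν ν x.2 N) := by
    rw [comm_apply, ← postcomp_mul, ← postcomp_mul, ← map_sub]
    rfl
  have h6 : ∀ (a b : Module.End K (MultilinearMap K (fun _ : ι => P) Q)) y,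
      comm K (a - b) y = comm K a y - comm K b y := fun a b y => by
    simp only [comm_apply, sub_mul, mul_sub]; abel
  rw [invOp, invOp, h1, slotDelta, h6, map_add, map_add, h2, h3, h4, h5]
  abel

/-- The multilinear operators all of whose values lie in `Z`. -/
def valuesIn (ι P : Type*) [AddCommGroup P] [Module K P] (Z : Submodule K Q) :
    Submodule K (MultilinearMap K (fun _ : ι => P) Q) where
  carrier := {B | ∀ ξ, B ξ ∈ Z}
  zero_mem' _ := Z.zero_mem
  add_mem' h h' ξ := Z.add_mem (h ξ) (h' ξ)
  smul_mem' a _ h ξ := Z.smul_mem a (h ξ)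

theorem invOp_mem_valuesIn {Z : Submodule K Q} {N : Module.End K Q} (hN : ∀ q ∈ Z, N q ∈ Z)
    (N' : ι → Module.End K P) (B) (hB : B ∈ valuesIn ι P Z) : invOp N N' B ∈ valuesIn ι P Z := by
  intro ξ
  rw [invOp_apply]
  exact Z.add_mem (hN _ (hB ξ)) (Z.sum_mem fun i _ => hB _)

theorem hasOrder_zero {I X : Type*} [Zero X] {δ : I → X → X} (hδ : ∀ i, δ i 0 = 0)
    {R : X → Prop} (hR : R 0) (s : ℕ) : HasOrder δ R s 0 := by
  induction s with
  | zero => exact ⟨hR, hδ⟩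
  | succ s ih => exact fun i => by rw [hδ]; exact ih

/-- The operator of the invariance equation has the order of `N` and `N'`: a commutator with a
`δ_{c,i}` replaces `N` by `δ_c(N)`, the operator in the `i`-th argument by `δ_c(N')`, and those in
the other arguments by zero. -/
theorem hasOrder_invOp {μ : C → Module.End K P} {ν : C → Module.End K Q} {Z : Submodule K Q}
    {s : ℕ} : ∀ {N : Module.End K Q} {N' : ι → Module.End K P},
    HasOrder (opDelta ν ν) (fun X => ∀ q ∈ Z, X q ∈ Z) s N →
    (∀ i, HasOrder (opDelta μ μ) (fun _ => True) s (N' i)) →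
    HasOrder (fun x => comm K (slotDelta (ι := ι) μ ν x))
      (fun Ψ => ∀ v ∈ valuesIn ι P Z, Ψ v ∈ valuesIn ι P Z) s (invOp N N') := by
  induction s with
  | zero =>
    intro N N' hN hN'
    refine ⟨fun v hv => invOp_mem_valuesIn hN.1 N' v hv, fun x => ?_⟩
    simp only
    rw [comm_slotDelta_invOp, hN.2, (hN' x.1).2, Pi.single_zero, invOp_zero]
  | succ s ih =>
    intro N N' hN hN' x
    simp only
    rw [comm_slotDelta_invOp]
    refine ih (hN x.2) fun i => ?_
    by_cases h : i = x.1
    · subst h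
      rw [Pi.single_eq_same]
      exact hN' x.1 x.2
    · rw [Pi.single_eq_of_ne h]
      exact hasOrder_zero (opDelta_zero μ μ) trivial s

theorem commute_invOp (X : Module.End K Q) (Y : Module.End K P) (a b : ι → K) :
    Commute (invOp X fun i => a i • Y) (invOp X fun i => b i • Y) := by
  refine Commute.add_left (Commute.add_right (Commute.refl _) ?_) (Commute.add_right ?_ ?_)
  · exact Commute.sum_right _ _ _ fun i _ => commute_postcomp_precomp _ _ _
  · exact Commute.sum_left _ _ _ fun i _ => (commute_postcomp_precomp _ _ _).symm
  · refine Commute.sum_left _ _ _ fun i _ => Commute.sum_right _ _ _ fun j _ => ?_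
    by_cases h : i = j
    · subst h
      rw [map_smul, map_smul]
      exact ((Commute.refl _).smul_left _).smul_right _
    · exact commute_precomp h _ _

/-- Iterated commutators of `δ_{c,i}` with the operator of the invariance equation, whose arguments
carry weights `a`: only the weight of the `i`-th argument survives. -/
theorem comm_slotDelta_pow_invOp (μ : C → Module.End K P) (ν : C → Module.End K Q) (i : ι) (c : C)
    (m : ℕ) (N : Module.End K Q) (N' : Module.End K P) (a : ι → K) :
    ((comm K (slotDelta μ ν (i, c))) ^ m) (invOp N fun j => a j • N') =
      invOp ((opDelta ν ν c)^[m] N) fun j =>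
        (if m = 0 then a j else (Pi.single i (a i) : ι → K) j) • (opDelta μ μ c)^[m] N' := by
  induction m generalizing N N' a with
  | zero => simp
  | succ m ih =>
    have h1 : (Pi.single i (opDelta μ μ c (a i • N')) : ι → Module.End K P) =
        fun j => (Pi.single i (a i) : ι → K) j • opDelta μ μ c N' := by
      funext j
      by_cases h : j = i
      · subst h
        rw [Pi.single_eq_same, Pi.single_eq_same, opDelta_smul]
      · rw [Pi.single_eq_of_ne h, Pi.single_eq_of_ne h, zero_smul]
    rw [pow_succ, Module.End.mul_apply, comm_slotDelta_invOp]
    dsimp only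
    rw [h1, ih, Function.iterate_succ_apply, Function.iterate_succ_apply]
    congr 1
    funext j
    simp

end Multilinear

/-! ### Vanishing of invariant multilinear operators -/

section Vanishing

variable {K : Type*} [Field K]

section Reduction

variable {V : Type*} [AddCommGroup V] [Module K V]

/-- Letters of a word can be moved across an operator `Φ` of order `l + 1`, at the cost of terms in
which fewer of these letters act on the argument `A`. -/
theorem move_word_mem {I : Type*} {D : I → Module.End K V} (hD : ∀ i j, Commute (D i) (D j))
    {Z : Submodule K V} {l : ℕ} {Φ : Module.End K V}
    (hΦ : HasOrder (fun i => comm K (D i)) (fun Ψ => ∀ v ∈ Z, Ψ v ∈ Z) (l + 1) Φ) {d : ℕ} {A : V}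
    (hA : ∀ w : List I, w.length = d + 1 → word D w A = 0) (W : List I) (j : ℕ)
    (ih : ∀ w' w : List I, w'.Sublist W → w.length < j → w'.length + w.length = d →
      word D (w' ++ w) A ∈ Z) (u : List I) :
    ∀ v : List I, u.length + v.length = j → W.length + j = d + (l + 1) →
      word D W (word D u (Φ (word D v A))) ∈ Z →
      word D W (Φ (word D u (word D v A))) ∈ Z := by
  induction u with
  | nil => exact fun v _ _ h => h
  | cons b u ihu =>
    intro v hj hW h
    simp only [List.length_cons] at hj
    have e1 : word D (b :: u) (word D v A) = word D u (word D (b :: v) A) := by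
      rw [word_cons, word_cons, (commute_word hD b u).eq]
      simp only [Module.End.mul_apply]
    rw [e1]
    refine ihu (b :: v) (by simp only [List.length_cons]; omega) hW ?_
    have e2 : word D W (word D (b :: u) (Φ (word D v A))) =
        word D W (word D u (Φ (word D (b :: v) A))) +
          word D (W ++ u) (comm K (D b) Φ (word D v A)) := by
      rw [word_cons, word_cons, (commute_word hD b u).eq, word_append, comm_apply]
      simp only [Module.End.mul_apply, LinearMap.sub_apply, map_sub]
      abel
    rw [e2] at h
    refine (Z.add_mem_iff_left ?_).1 h
    refine word_apply_mem hD Z (W ++ u) l _ _ (hΦ b) (fun w' hw' hl => ?_) (fun w' hw' hl => ?_)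
    · obtain ⟨w₁, w₂, rfl, h1, h2⟩ := List.sublist_append_iff.1 hw'
      have h3 := h2.length_le
      have h4 := h1.length_le
      simp only [List.length_append] at hl
      have := ih w₁ (w₂ ++ v) h1 (by simp only [List.length_append]; omega)
        (by simp only [List.length_append]; omega)
      rwa [← List.append_assoc, word_append] at this
    · rw [← Module.End.mul_apply, ← word_append]
      refine word_eq_zero_of_le hA _ ?_
      simp only [List.length_append] at hl ⊢
      omega

end Reduction

variable {P Q : Type*} [AddCommGroup P] [Module K P] [AddCommGroup Q]
  [Module K Q] {C : Type*} {ι : Type*} [DecidableEq ι] [Fintype ι]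

theorem HasOrder.iterate_opDelta_eq_zero {κ : C → Module.End K P} {T : Module.End K P}
    {R : Module.End K P → Prop} {l : ℕ} (hT : HasOrder (opDelta κ κ) R l T) (a : C) (m : ℕ)
    (hm : l < m) : (opDelta κ κ a)^[m] T = 0 := by
  obtain ⟨m, rfl⟩ := Nat.exists_eq_add_of_lt hm
  rw [show l + m + 1 = m + 1 + l by omega, Function.iterate_add_apply, Function.iterate_succ_apply,
    (hT.iterate a).2 a]
  exact Function.iterate_fixed (opDelta_zero κ κ a) m

/-- If `Φ(B)` is annihilated, modulo `Z`, by the relevant monomials in `δ_{a,i₁}` and `δ_{a,i₂}`,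
then so is `B`: the top symbols of `Φ` in the two covectors are the coefficients of a polynomial to which
McCoy's theorem applies, as its coefficient at a mixed monomial is the composition with the symbol
of `N`, which is injective. -/
theorem divPow_mul_divPow_mem [CharZero K] {μ : C → Module.End K P} {ν : C → Module.End K Q}
    {i₁ i₂ : ι} (hi : i₁ ≠ i₂) {N : Module.End K Q} {N' : Module.End K P} {l : ℕ}
    {Z : Submodule K Q}
    (hl : 2 ≤ l) {a : C} (hinj : ∀ q, (opDelta ν ν a)^[l] N q ∈ Z → q ∈ Z)
    (hpres : ∀ q ∈ Z, (opDelta ν ν a)^[l] N q ∈ Z)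
    (hNz : ∀ m, l < m → (opDelta ν ν a)^[m] N = 0) (hN'z : ∀ m, l < m → (opDelta μ μ a)^[m] N' = 0)
    {e : ℕ} {B : MultilinearMap K (fun _ : ι => P) Q}
    (hB : ∀ p q, e < p + q → ((slotDelta μ ν (i₁, a)) ^ p * (slotDelta μ ν (i₂, a)) ^ q) B = 0)
    (hΦ : ∀ p q, p + q = e + l → ((slotDelta μ ν (i₁, a)) ^ p * (slotDelta μ ν (i₂, a)) ^ q)
      (invOp N (fun _ => N') B) ∈ valuesIn ι P Z) {p q : ℕ} (hpq : p + q = e) :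
    ((slotDelta μ ν (i₁, a)) ^ p * (slotDelta μ ν (i₂, a)) ^ q) B ∈ valuesIn ι P Z := by
  set D₁ := slotDelta (ι := ι) μ ν (i₁, a) with hD₁
  set D₂ := slotDelta (ι := ι) μ ν (i₂, a) with hD₂
  set X := (opDelta ν ν a)^[l] N with hX
  set Y := (opDelta μ μ a)^[l] N' with hY
  set Φ := invOp N (fun _ : ι => N') with hΦdef
  have hinvz : ∀ b : ι → K, invOp (0 : Module.End K Q) (fun j => b j • (0 : Module.End K P)) = 0 := by
    intro b
    simp only [smul_zero]
    exact invOp_zero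
  -- the iterated commutators of the two operators with `Φ`
  have hcomm : ∀ m₁ m₂, ∃ b : ι → K, (1 ≤ m₁ → 1 ≤ m₂ → b = 0) ∧
      ((comm K D₁) ^ m₁) (((comm K D₂) ^ m₂) Φ) =
        invOp ((opDelta ν ν a)^[m₁ + m₂] N) fun j => b j • (opDelta μ μ a)^[m₁ + m₂] N' := by
    intro m₁ m₂
    have h0 : Φ = invOp N fun j => (1 : ι → K) j • N' := by simp [hΦdef]
    rw [h0, comm_slotDelta_pow_invOp]
    rw [comm_slotDelta_pow_invOp, ← Function.iterate_add_apply, ← Function.iterate_add_apply]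
    refine ⟨_, fun h1 h2 => ?_, rfl⟩
    funext j
    rw [if_neg (by omega), if_neg (by omega), Pi.single_eq_of_ne hi, Pi.single_zero]
  have htop : ∀ i, i ≤ l → ∃ b : ι → K, (1 ≤ i → i < l → b = 0) ∧
      ((comm K D₁) ^ (l - i)) (((comm K D₂) ^ i) Φ) = invOp X fun j => b j • Y := by
    intro i hil
    obtain ⟨b, hb, h⟩ := hcomm (l - i) i
    rw [Nat.sub_add_cancel hil] at h
    exact ⟨b, fun h1 h2 => hb (by omega) h1, h⟩
  have hgt : ∀ m₁ m₂, l < m₁ + m₂ → ((comm K D₁) ^ m₁) (((comm K D₂) ^ m₂) Φ) = 0 := by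
    intro m₁ m₂ hm
    obtain ⟨b, _, h⟩ := hcomm m₁ m₂
    rw [h, hNz _ hm, hN'z _ hm, hinvz]
  -- the coefficients of the polynomials of McCoy's theorem: the symbol of `Φ` and that of `B` along
  -- the pencil of the two covectors
  let T : ℕ → Module.End K (MultilinearMap K (fun _ : ι => P) Q) := fun i =>
    if i ≤ l then divPow K (comm K D₁) (l - i) (divPow K (comm K D₂) i Φ) else 0
  let y : ℕ → MultilinearMap K (fun _ : ι => P) Q := fun q =>
    if q ≤ e then (divPow K D₁ (e - q) * divPow K D₂ q) B else 0
  have hT : ∀ i, ∃ (r : K) (b : ι → K), (1 ≤ i → i < l → r ≠ 0 ∧ b = 0) ∧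
      T i = r • invOp X fun j => b j • Y := by
    intro i
    by_cases hil : i ≤ l
    · obtain ⟨b, hb, h⟩ := htop i hil
      refine ⟨(i.factorial : K)⁻¹ * ((l - i).factorial : K)⁻¹, b, fun h1 h2 => ⟨?_, hb h1 h2⟩, ?_⟩
      · exact mul_ne_zero (inv_ne_zero (Nat.cast_ne_zero.2 (Nat.factorial_ne_zero _)))
          (inv_ne_zero (Nat.cast_ne_zero.2 (Nat.factorial_ne_zero _)))
      · simp only [T, if_pos hil, divPow, LinearMap.smul_apply, map_smul, h, smul_smul]
    · exact ⟨0, 0, fun _ h => absurd h.le hil, by simp only [T, if_neg hil, zero_smul]⟩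
  have key := mem_of_convolution_mem (valuesIn ι P Z) T (fun i j => ?_) (fun i v hv => ?_) (i₀ := 1)
    (fun v hv => ?_) (e + 1) l y (fun q hq => ?_) (by omega) (fun m => ?_) q
  · have hq : q ≤ e := by omega
    have hp : e - q = p := by omega
    simp only [y, if_pos hq, hp, divPow, smul_mul_smul_comm, LinearMap.smul_apply] at key
    refine (Submodule.smul_mem_iff _ ?_).1 key
    exact mul_ne_zero (inv_ne_zero (Nat.cast_ne_zero.2 (Nat.factorial_ne_zero _)))
          (inv_ne_zero (Nat.cast_ne_zero.2 (Nat.factorial_ne_zero _)))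
  · obtain ⟨r, b, _, h⟩ := hT i
    obtain ⟨r', b', _, h'⟩ := hT j
    rw [h, h']
    exact ((commute_invOp X Y b b').smul_left r).smul_right r'
  · obtain ⟨r, b, _, h⟩ := hT i
    rw [h]
    exact Submodule.smul_mem _ _ (invOp_mem_valuesIn hpres _ v hv)
  · obtain ⟨r, b, hb, h⟩ := hT 1
    obtain ⟨hr, rfl⟩ := hb le_rfl (by omega)
    rw [h, LinearMap.smul_apply, Submodule.smul_mem_iff _ hr] at hv
    intro ξ
    have := hv ξ
    rw [invOp_apply] at this
    simp only [Pi.zero_apply, zero_smul, LinearMap.zero_apply, MultilinearMap.map_update_zero,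
      Finset.sum_const_zero, add_zero] at this
    exact hinj _ this
  · simp only [y]
    rw [if_neg (by omega)]
    exact Submodule.zero_mem _
  · -- the convolution is the Leibniz expansion of `D₁^p D₂^m Φ B`, where `p + m = e + l`
    by_cases hm : m ≤ e + l
    · have h1 := hΦ (e + l - m) m (by omega)
      have h2 : (divPow K D₁ (e + l - m) * divPow K D₂ m * Φ) B ∈ valuesIn ι P Z := by
        rw [divPow, divPow, smul_mul_smul_comm, smul_mul_assoc]
        exact Submodule.smul_mem _ _ h1
      rw [mul_assoc, divPow_mul D₂ Φ, Finset.mul_sum, LinearMap.sum_apply] at h2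
      convert h2 using 2 with ij hij
      have hij' : ij.1 + ij.2 = m := Finset.HasAntidiagonal.mem_antidiagonal.1 hij
      rw [← mul_assoc, divPow_mul, Finset.sum_mul, LinearMap.sum_apply]
      have hzero : ∀ kp : ℕ × ℕ, kp ∈ Finset.HasAntidiagonal.antidiagonal (e + l - m) →
          ¬ (kp.1 + ij.1 = l) →
          (divPow K (comm K D₁) kp.1 (divPow K (comm K D₂) ij.1 Φ) * divPow K D₁ kp.2 *
            divPow K D₂ ij.2) B = 0 := by
        intro kp hkp hne
        have hkp' : kp.1 + kp.2 = e + l - m := Finset.HasAntidiagonal.mem_antidiagonal.1 hkp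
        rw [mul_assoc, Module.End.mul_apply]
        rcases Nat.lt_or_gt_of_ne hne with h3 | h3
        · have h4 : (divPow K D₁ kp.2 * divPow K D₂ ij.2) B = 0 := by
            simp only [divPow, smul_mul_smul_comm, LinearMap.smul_apply]
            rw [hB _ _ (by omega), smul_zero]
          rw [h4, map_zero]
        · have h4 : divPow K (comm K D₁) kp.1 (divPow K (comm K D₂) ij.1 Φ) = 0 := by
            simp only [divPow, LinearMap.smul_apply, map_smul]
            rw [hgt _ _ h3, smul_zero, smul_zero]
          rw [h4, LinearMap.zero_apply]
      by_cases hle : ij.1 ≤ l ∧ ij.2 ≤ e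
      · rw [Finset.sum_eq_single (l - ij.1, e - ij.2)]
        · simp only [T, y, if_pos hle.1, if_pos hle.2, Module.End.mul_apply]
        · refine fun kp hkp hne => hzero kp hkp fun h3 => hne ?_
          have hkp' : kp.1 + kp.2 = e + l - m := Finset.HasAntidiagonal.mem_antidiagonal.1 hkp
          exact Prod.ext (by dsimp only; omega) (by dsimp only; omega)
        · exact fun h3 => absurd
            (Finset.HasAntidiagonal.mem_antidiagonal.2 (by dsimp only; omega)) h3
      · rw [Finset.sum_eq_zero fun kp hkp => hzero kp hkp fun h3 => ?_]
        · by_cases h3 : ij.1 ≤ l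
          · have h4 : ¬ ij.2 ≤ e := fun h4 => hle ⟨h3, h4⟩
            simp only [y, if_neg h4, map_zero, ite_self]
          · rw [if_neg h3]
        · have hkp' : kp.1 + kp.2 = e + l - m := Finset.HasAntidiagonal.mem_antidiagonal.1 hkp
          omega
    · refine Submodule.sum_mem _ fun ij hij => ?_
      have hij' : ij.1 + ij.2 = m := Finset.HasAntidiagonal.mem_antidiagonal.1 hij
      split_ifs with h3
      · have h4 : ¬ ij.2 ≤ e := by omega
        simp only [y, if_neg h4, map_zero]
        exact Submodule.zero_mem _
      · exact Submodule.zero_mem _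

/-- If the words of length `d + 1` annihilate a solution `A` of the invariance equation, then the
words of length `d` map it into `Z`. -/
theorem word_mem_valuesIn [CharZero K] {μ : C → Module.End K P} {ν : C → Module.End K Q}
    (hμ : ∀ c c', Commute (μ c) (μ c')) (hν : ∀ c c', Commute (ν c) (ν c'))
    {i₁ i₂ : ι} (hi : i₁ ≠ i₂) {N : Module.End K Q} {N' : Module.End K P} {l : ℕ}
    {Z : Submodule K Q} (hl : 2 ≤ l)
    (hN : HasOrder (opDelta ν ν) (fun X => ∀ q ∈ Z, X q ∈ Z) l N)
    (hN' : HasOrder (opDelta μ μ) (fun _ => True) l N')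
    {a : C} (hinj : ∀ q, (opDelta ν ν a)^[l] N q ∈ Z → q ∈ Z)
    {A : MultilinearMap K (fun _ : ι => P) Q} {d : ℕ}
    (hA : ∀ w : List (ι × C), w.length = d + 1 → word (slotDelta μ ν) w A = 0)
    (hΦ : invOp N (fun _ => N') A = 0) (w : List (ι × C)) (hw : w.length = d) :
    word (slotDelta μ ν) w A ∈ valuesIn ι P Z := by
  have hD := commute_slotDelta (ι := ι) hμ hν
  have hPhi := hasOrder_invOp (ι := ι) hN (N' := fun _ => N') fun _ => hN'
  have hpow : ∀ p q : ℕ, word (slotDelta (ι := ι) μ ν)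
      (List.replicate p (i₁, a) ++ List.replicate q (i₂, a)) =
      slotDelta μ ν (i₁, a) ^ p * slotDelta μ ν (i₂, a) ^ q := fun p q => by
    rw [word_append, word_replicate, word_replicate]
  -- induction on the number of letters other than `δ_{a,i₁}` and `δ_{a,i₂}`
  have claim : ∀ j : ℕ, ∀ u : List (ι × C), u.length = j → ∀ p q, p + q + j = d →
      (slotDelta μ ν (i₁, a) ^ p * slotDelta μ ν (i₂, a) ^ q) (word (slotDelta μ ν) u A) ∈
        valuesIn ι P Z := by
    intro j
    induction j using Nat.strong_induction_on with
    | _ j ih =>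
      intro u hu p q hpq
      refine divPow_mul_divPow_mem hi hl hinj (hN.iterate a).1 (hN.iterate_opDelta_eq_zero a)
        (hN'.iterate_opDelta_eq_zero a)
        (e := d - j) (fun p q h => ?_) (fun p q h => ?_) (by omega)
      · rw [← hpow, ← Module.End.mul_apply, ← word_append]
        refine word_eq_zero_of_le hA _ ?_
        simp only [List.length_append, List.length_replicate]
        omega
      · obtain ⟨l, rfl⟩ : ∃ l', l = l' + 1 := ⟨l - 1, by omega⟩
        rw [← hpow]
        refine move_word_mem hD hPhi hA
          (List.replicate p (i₁, a) ++ List.replicate q (i₂, a)) j (fun w' w hw' hwj hd => ?_) u []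
          (by simpa using hu) (by simp only [List.length_append, List.length_replicate]; omega) ?_
        · obtain ⟨w₁, w₂, rfl, h1, h2⟩ := List.sublist_append_iff.1 hw'
          obtain ⟨p', _, rfl⟩ := List.sublist_replicate_iff.1 h1
          obtain ⟨q', _, rfl⟩ := List.sublist_replicate_iff.1 h2
          rw [word_append, hpow, Module.End.mul_apply]
          refine ih _ hwj w rfl p' q' ?_
          simpa using hd
        · change word (slotDelta μ ν) _ (word (slotDelta μ ν) _ (invOp N (fun _ => N') A)) ∈ _
          rw [hΦ, map_zero, map_zero]
          exact Submodule.zero_mem _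
  have := claim d w hw 0 0 (by omega)
  simpa using this

/-- A multilinear operator `A` of finite order with `N(A(ξ)) + ∑ᵢ A(…, N'(ξᵢ), …) = 0` vanishes,
if `N` and `N'` have order at most `l`, `l ≥ 2`, there are at least two arguments, and for enough
submodules `Z` (those of the sections that vanish at a given point) `N` acts on `Q / Z` with an
injective symbol. -/
theorem eq_zero_of_invOp_eq_zero [CharZero K] {μ : C → Module.End K P} {ν : C → Module.End K Q}
    (hμ : ∀ c c', Commute (μ c) (μ c')) (hν : ∀ c c', Commute (ν c) (ν c'))
    {i₁ i₂ : ι} (hi : i₁ ≠ i₂) {N : Module.End K Q} {N' : Module.End K P} {l : ℕ} (hl : 2 ≤ l)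
    (S : Set (Submodule K Q)) (hS : ∀ q, (∀ Z ∈ S, q ∈ Z) → q = 0)
    (hN : ∀ Z ∈ S, HasOrder (opDelta ν ν) (fun X => ∀ q ∈ Z, X q ∈ Z) l N)
    (hN' : HasOrder (opDelta μ μ) (fun _ => True) l N')
    (hinj : ∀ Z ∈ S, ∃ a, ∀ q, (opDelta ν ν a)^[l] N q ∈ Z → q ∈ Z)
    {A : MultilinearMap K (fun _ : ι => P) Q} {d : ℕ}
    (hA : ∀ w : List (ι × C), w.length = d → word (slotDelta μ ν) w A = 0)
    (hΦ : invOp N (fun _ => N') A = 0) : A = 0 := by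
  induction d with
  | zero => simpa [word] using hA [] rfl
  | succ d ih =>
    refine ih fun w hw => ?_
    ext ξ
    refine hS _ fun Z hZ => ?_
    obtain ⟨a, ha⟩ := hinj Z hZ
    exact word_mem_valuesIn hμ hν hi hl (hN Z hZ) hN' ha hA hΦ w hw ξ

/-- A multilinear operator of order less than `m` in each argument has finite order. -/
theorem word_eq_zero_of_slots {μ : C → Module.End K P} {ν : C → Module.End K Q}
    (hμ : ∀ c c', Commute (μ c) (μ c')) (hν : ∀ c c', Commute (ν c) (ν c'))
    {A : MultilinearMap K (fun _ : ι => P) Q} {m : ℕ}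
    (hA : ∀ (i : ι) (w : List C), w.length = m →
      word (slotDelta μ ν) (w.map fun c => (i, c)) A = 0)
    (w : List (ι × C)) (hw : w.length = Fintype.card ι * m + 1) :
    word (slotDelta μ ν) w A = 0 := by
  have hD := commute_slotDelta (ι := ι) hμ hν
  -- some argument occurs in at least `m` letters
  obtain ⟨i, hi⟩ : ∃ i, m ≤ (w.filter fun x => x.1 = i).length := by
    by_contra! h
    have h1 : ∑ i : ι, (w.filter fun x => x.1 = i).length = w.length := by
      clear hw h
      induction w with
      | nil => simp
      | cons b w ih =>
        have : ∀ i, (List.filter (fun x => decide (x.1 = i)) (b :: w)).length =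
            (if b.1 = i then 1 else 0) + (List.filter (fun x => decide (x.1 = i)) w).length := by
          intro i
          by_cases h : b.1 = i
          · simp [h]; omega
          · simp [h]
        simp only [this, Finset.sum_add_distrib, ih, Finset.sum_ite_eq, Finset.mem_univ, if_true,
          List.length_cons]
        omega
    have h2 : ∑ i : ι, (w.filter fun x => x.1 = i).length ≤ ∑ _i : ι, m :=
      Finset.sum_le_sum fun i _ => (h i).le
    rw [h1, hw, Finset.sum_const, smul_eq_mul, Finset.card_univ] at h2
    omega
  set w₁ := w.filter fun x => x.1 = i with hw₁
  set w₂ := w.filter fun x => !(decide (x.1 = i)) with hw₂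
  have hp : (w₁ ++ w₂).Perm w := List.filter_append_perm _ w
  have h1 : word (slotDelta μ ν) w = word (slotDelta (ι := ι) μ ν) (w₁ ++ w₂) := by
    refine (List.Perm.prod_eq' (hp.map _) ?_).symm
    rw [List.pairwise_map]
    exact List.pairwise_of_forall fun x y => hD x y
  have h2 : w₁ = (w₁.map Prod.snd).map fun c => (i, c) := by
    rw [List.map_map]
    conv_lhs => rw [← List.map_id w₁]
    refine List.map_congr_left fun x hx => ?_
    have : x.1 = i := by simpa using (List.mem_filter.1 hx).2
    simp [← this]
  rw [h1, word_append, (commute_word_word hD w₁ w₂).eq, Module.End.mul_apply, h2,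
    ← List.take_append_drop ((w₁.map Prod.snd).length - m) (w₁.map Prod.snd), List.map_append,
    word_append, Module.End.mul_apply, hA, map_zero, map_zero]
  simp only [List.length_drop, List.length_map]
  omega

end Vanishing

/-! ### Functions vanishing to a given order -/

section VanishingOrder

variable {W G : Type*} [NormedAddCommGroup W] [NormedSpace ℝ W] [NormedAddCommGroup G]
  [NormedSpace ℝ G]

/-- `u` is smooth near `y`. -/
def SmoothNear (u : W → G) (y : W) : Prop := ∀ᶠ z in 𝓝 y, ContDiffAt ℝ ∞ u z

/-- The derivatives of `u` of order less than `m` vanish at `y`. -/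
def VanishesTo (m : ℕ) (u : W → G) (y : W) : Prop := ∀ i < m, iteratedFDeriv ℝ i u y = 0

theorem SmoothNear.contDiffAt {u : W → G} {y : W} (h : SmoothNear u y) {i : ℕ} :
    ContDiffAt ℝ i u y :=
  h.self_of_nhds.of_le (by exact_mod_cast le_top)

theorem SmoothNear.congr {u v : W → G} {y : W} (h : SmoothNear u y) (huv : v =ᶠ[𝓝 y] u) :
    SmoothNear v y := by
  filter_upwards [h, huv.eventuallyEq_nhds] with z h1 h2
  exact h1.congr_of_eventuallyEq h2

theorem smoothNear_const (a : G) (y : W) : SmoothNear (fun _ : W => a) y :=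
  Eventually.of_forall fun _ => contDiffAt_const

theorem SmoothNear.sub {u v : W → G} {y : W} (h : SmoothNear u y) (h' : SmoothNear v y) :
    SmoothNear (u - v) y := by
  filter_upwards [h, h'] with z h1 h2
  exact h1.sub h2

theorem SmoothNear.const_smul {u : W → G} {y : W} (h : SmoothNear u y) (a : ℝ) :
    SmoothNear (a • u) y := by
  filter_upwards [h] with z h1
  exact h1.const_smul a

theorem SmoothNear.smul {h : W → ℝ} {u : W → G} {y : W} (hh : SmoothNear h y)
    (hu : SmoothNear u y) : SmoothNear (fun z => h z • u z) y := by
  filter_upwards [hh, hu] with z h1 h2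
  exact h1.smul h2

theorem SmoothNear.pow {h : W → ℝ} {y : W} (hh : SmoothNear h y) (m : ℕ) :
    SmoothNear (fun z => h z ^ m) y := by
  filter_upwards [hh] with z h1
  exact h1.pow m

theorem SmoothNear.bilinear {G₁ G₂ : Type*} [NormedAddCommGroup G₁] [NormedSpace ℝ G₁]
    [NormedAddCommGroup G₂] [NormedSpace ℝ G₂] (B : G →L[ℝ] G₁ →L[ℝ] G₂) {u : W → G} {v : W → G₁}
    {y : W} (hu : SmoothNear u y) (hv : SmoothNear v y) : SmoothNear (fun z => B (u z) (v z)) y := by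
  filter_upwards [hu, hv] with z h1 h2
  exact B.isBoundedBilinearMap.contDiff.contDiffAt.comp z (h1.prodMk h2)

/-- Leibniz' rule: a bilinear expression in two functions that vanish to the orders `m` and `m'`
vanishes to the order `m + m'`. -/
theorem VanishesTo.bilinear {G₁ G₂ : Type*} [NormedAddCommGroup G₁] [NormedSpace ℝ G₁]
    [NormedAddCommGroup G₂] [NormedSpace ℝ G₂] (B : G →L[ℝ] G₁ →L[ℝ] G₂) {u : W → G} {v : W → G₁}
    {y : W} {m m' : ℕ} (hu : SmoothNear u y) (hv : SmoothNear v y) (hm : VanishesTo m u y)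
    (hm' : VanishesTo m' v y) : VanishesTo (m + m') (fun z => B (u z) (v z)) y := by
  intro i hi
  obtain ⟨s, hs, hso, hys⟩ := eventually_nhds_iff.1 (hu.and hv)
  have h1 : ContDiffOn ℝ ∞ u s := fun z hz => (hs z hz).1.contDiffWithinAt
  have h2 : ContDiffOn ℝ ∞ v s := fun z hz => (hs z hz).2.contDiffWithinAt
  have h3 := B.norm_iteratedFDerivWithin_le_of_bilinear h1 h2 hso.uniqueDiffOn hys
    (n := i) (by exact_mod_cast le_top)
  simp only [iteratedFDerivWithin_of_isOpen _ hso hys] at h3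
  rw [Finset.sum_eq_zero, mul_zero] at h3
  · exact norm_le_zero_iff.1 h3
  · intro j hji
    have hji := Finset.mem_range.1 hji
    by_cases hj : j < m
    · rw [hm j hj, norm_zero, mul_zero, zero_mul]
    · rw [hm' (i - j) (by omega), norm_zero, mul_zero]

theorem vanishesTo_zero (u : W → G) (y : W) : VanishesTo 0 u y := fun _ h => absurd h (by omega)

theorem vanishesTo_one {u : W → G} {y : W} (h : u y = 0) : VanishesTo 1 u y := by
  intro i hi
  obtain rfl : i = 0 := by omega
  ext m
  simpa using h

theorem VanishesTo.smul {h : W → ℝ} {u : W → G} {y : W} {m m' : ℕ} (hh : SmoothNear h y)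
    (hu : SmoothNear u y) (hm : VanishesTo m h y) (hm' : VanishesTo m' u y) :
    VanishesTo (m + m') (fun z => h z • u z) y :=
  VanishesTo.bilinear (ContinuousLinearMap.lsmul ℝ ℝ) hh hu hm hm'

theorem VanishesTo.pow {h : W → ℝ} {y : W} (hh : SmoothNear h y) (h0 : h y = 0) (m : ℕ) :
    VanishesTo m (fun z => h z ^ m) y := by
  induction m with
  | zero => exact vanishesTo_zero _ _
  | succ m ih => simpa only [pow_succ, smul_eq_mul] using ih.smul (hh.pow m) hh (vanishesTo_one h0)

variable {n : ℕ}

theorem pderiv_add {i : ℕ} (σ : Fin i → Fin n) {u v : Eu n → G} {y : Eu n} (hu : SmoothNear u y)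
    (hv : SmoothNear v y) : pderiv σ (u + v) y = pderiv σ u y + pderiv σ v y := by
  unfold pderiv
  rw [iteratedFDeriv_add_apply hu.contDiffAt hv.contDiffAt]
  rfl

theorem pderiv_const_smul {i : ℕ} (σ : Fin i → Fin n) {u : Eu n → G} {y : Eu n}
    (hu : SmoothNear u y) (a : ℝ) : pderiv σ (a • u) y = a • pderiv σ u y := by
  unfold pderiv
  rw [iteratedFDeriv_const_smul_apply hu.contDiffAt]
  rfl

theorem VanishesTo.pderiv_eq_zero {m i : ℕ} {u : Eu n → G} {y : Eu n} (h : VanishesTo m u y)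
    (hi : i < m) (σ : Fin i → Fin n) : pderiv σ u y = 0 := by
  unfold pderiv
  rw [h i hi]
  rfl

theorem pderiv_smul_const {i : ℕ} (σ : Fin i → Fin n) {h : Eu n → ℝ} {y : Eu n}
    (hh : SmoothNear h y) (w : G) : pderiv σ (fun z => h z • w) y = pderiv σ h y • w := by
  unfold pderiv
  have := ContinuousLinearMap.iteratedFDeriv_comp_left
    ((ContinuousLinearMap.id ℝ ℝ).smulRight w) (hh.contDiffAt (i := i)) (i := i) le_rfl
  exact congrArg (fun T : ContinuousMultilinearMap ℝ (fun _ : Fin i => Eu n) G =>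
    T fun j => EuclideanSpace.single (σ j) (1 : ℝ)) this

/-- The derivatives of order `i` of `h^i u`, where `h` vanishes at `y`, depend on `u(y)` only. -/
theorem pderiv_pow_smul {i : ℕ} (σ : Fin i → Fin n) {h : Eu n → ℝ} {u : Eu n → G} {y : Eu n}
    (hh : SmoothNear h y) (h0 : h y = 0) (hu : SmoothNear u y) :
    pderiv σ (fun z => h z ^ i • u z) y = pderiv σ (fun z => h z ^ i) y • u y := by
  have e : (fun z => h z ^ i • u z) =
      (fun z => h z ^ i • (u z - u y)) + fun z => h z ^ i • u y := by
    funext z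
    simp [smul_sub]
  have hs : SmoothNear (fun z => u z - u y) y := hu.sub (smoothNear_const _ _)
  have hv := (VanishesTo.pow hh h0 i).smul (hh.pow i) hs
    (vanishesTo_one (u := fun z => u z - u y) (sub_self _))
  rw [e, pderiv_add σ ((hh.pow i).smul hs) ((hh.pow i).smul (smoothNear_const _ _)),
    pderiv_smul_const σ (hh.pow i), hv.pderiv_eq_zero (Nat.lt_succ_self i), zero_add]

end VanishingOrder

/-! ### Differential operators at a point -/

section Pointwise

variable {n : ℕ} {M : Type*} [TopologicalSpace M] [ChartedSpace (Eu n) M] [IsManifold (𝓡 n) ∞ M]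
  {F : Type*} [NormedAddCommGroup F] [NormedSpace ℝ F]
  {E : M → Type*} [TopologicalSpace (TotalSpace F E)] [∀ x, AddCommGroup (E x)]
  [∀ x, Module ℝ (E x)] [∀ x, TopologicalSpace (E x)] [FiberBundle F E] [VectorBundle ℝ F E]
  {G : Type*} [NormedAddCommGroup G] [NormedSpace ℝ G]
  {V : M → Type*} [TopologicalSpace (TotalSpace G V)] [∀ x, AddCommGroup (V x)]
  [∀ x, Module ℝ (V x)] [∀ x, TopologicalSpace (V x)] [FiberBundle G V] [VectorBundle ℝ G V]
  {G₁ : Type*} [NormedAddCommGroup G₁] [NormedSpace ℝ G₁]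
  {V₁ : M → Type*} [TopologicalSpace (TotalSpace G₁ V₁)] [∀ x, AddCommGroup (V₁ x)]
  [∀ x, Module ℝ (V₁ x)] [∀ x, TopologicalSpace (V₁ x)] [FiberBundle G₁ V₁] [VectorBundle ℝ G₁ V₁]
  {G₂ : Type*} [NormedAddCommGroup G₂] [NormedSpace ℝ G₂]
  {V₂ : M → Type*} [TopologicalSpace (TotalSpace G₂ V₂)] [∀ x, AddCommGroup (V₂ x)]
  [∀ x, Module ℝ (V₂ x)] [∀ x, TopologicalSpace (V₂ x)] [FiberBundle G₂ V₂] [VectorBundle ℝ G₂ V₂]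

theorem fib_eq_zero_iff {x : M} {v : V x} : fib G V x x v = 0 ↔ v = 0 := by
  refine ⟨fun h => ?_, fun h => by rw [h, map_zero]⟩
  have h1 := congrArg ((trivializationAt G V x).symmL ℝ x) h
  unfold fib at h1
  rwa [Trivialization.symmL_continuousLinearMapAt _ (mem_baseSet_trivializationAt G V x),
    map_zero] at h1

theorem fib_injective (x : M) : Function.Injective (fib G V x x) :=
  (injective_iff_map_eq_zero _).2 fun _ h => fib_eq_zero_iff.1 h

theorem gam_ext {p q : Gam n F E G V} (h : ∀ x s t, p.1 (pt x s t) = q.1 (pt x s t)) : p = q := by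
  refine Subtype.ext (funext fun ρ => ?_)
  rw [← ρ.pt_eta]
  exact h _ _ _

/-- The restriction of `p` to the infinite jet of the section `s` at the time `t`, in the
coordinates around `x`. -/
noncomputable def coord (p : Gam n F E G V) (x : M) (s : Sec n F E) (t : ℝ) : Eu n → G :=
  localRep n G V x fun x' => p.1 (pt x' s t)

theorem coord_self (p : Gam n F E G V) (x : M) (s : Sec n F E) (t : ℝ) :
    coord p x s t (chartAt (Eu n) x x) = fib G V x x (p.1 (pt x s t)) :=
  congrArg (fun x' => fib G V x x' (p.1 (pt x' s t)))
    ((chartAt (Eu n) x).left_inv (mem_chart_source _ x))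

theorem coord_add (p q : Gam n F E G V) (x : M) (s : Sec n F E) (t : ℝ) :
    coord (p + q) x s t = coord p x s t + coord q x s t := by
  funext y
  exact map_add (fib G V x _) _ _

theorem coord_smul (a : ℝ) (p : Gam n F E G V) (x : M) (s : Sec n F E) (t : ℝ) :
    coord (a • p) x s t = a • coord p x s t := by
  funext y
  exact map_smul (fib G V x _) _ _

/-- Multiplication by a smooth function on `M`, as a linear map. -/
noncomputable def mulBase (n : ℕ) {M : Type*} [TopologicalSpace M] [ChartedSpace (Eu n) M]
    [IsManifold (𝓡 n) ∞ M]
    (F : Type*) [NormedAddCommGroup F] [NormedSpace ℝ F]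
    (E : M → Type*) [TopologicalSpace (TotalSpace F E)] [∀ x, AddCommGroup (E x)]
    [∀ x, Module ℝ (E x)] [∀ x, TopologicalSpace (E x)] [FiberBundle F E] [VectorBundle ℝ F E]
    (G : Type*) [NormedAddCommGroup G] [NormedSpace ℝ G]
    (V : M → Type*) [TopologicalSpace (TotalSpace G V)] [∀ x, AddCommGroup (V x)]
    [∀ x, Module ℝ (V x)] [∀ x, TopologicalSpace (V x)] [FiberBundle G V] [VectorBundle ℝ G V]
    (a : C^∞⟮𝓡 n, M; 𝓘(ℝ), ℝ⟯) : Module.End ℝ (Gam n F E G V) where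
  toFun := smulBase a
  map_add' p q := Subtype.ext (funext fun ρ => smul_add (a ρ.base) (p.1 ρ) (q.1 ρ))
  map_smul' c p := Subtype.ext (funext fun ρ => smul_comm (a ρ.base) c (p.1 ρ))

theorem commute_mulBase (a b : C^∞⟮𝓡 n, M; 𝓘(ℝ), ℝ⟯) :
    Commute (mulBase n F E G V a) (mulBase n F E G V b) :=
  LinearMap.ext fun p => Subtype.ext (funext fun ρ => smul_comm (a ρ.base) (b ρ.base) (p.1 ρ))

/-- The commutator of an operator with the multiplication by a smooth function on `M`. -/
noncomputable abbrev fnDelta (a : C^∞⟮𝓡 n, M; 𝓘(ℝ), ℝ⟯) (Δ : Gam n F E G₁ V₁ →ₗ[ℝ] Gam n F E G₂ V₂) :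
    Gam n F E G₁ V₁ →ₗ[ℝ] Gam n F E G₂ V₂ :=
  opDelta (mulBase n F E G₁ V₁) (mulBase n F E G₂ V₂) a Δ

theorem coe_fnDelta_iterate (a : C^∞⟮𝓡 n, M; 𝓘(ℝ), ℝ⟯)
    (Δ : Gam n F E G₁ V₁ →ₗ[ℝ] Gam n F E G₂ V₂) (l : ℕ) :
    ((fnDelta a)^[l] Δ : Gam n F E G₁ V₁ → Gam n F E G₂ V₂) = (delta a)^[l] Δ := by
  induction l generalizing Δ with
  | zero => rfl
  | succ l ih => exact ih (fnDelta a Δ)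

/-- The local coordinate expression of `a(x) - a`, for a smooth function `a` on `M`. -/
noncomputable def fnDiff (a : C^∞⟮𝓡 n, M; 𝓘(ℝ), ℝ⟯) (x : M) (y : Eu n) : ℝ :=
  a x - a ((chartAt (Eu n) x).symm y)

theorem fnDiff_self (a : C^∞⟮𝓡 n, M; 𝓘(ℝ), ℝ⟯) (x : M) :
    fnDiff a x (chartAt (Eu n) x x) = 0 := by
  rw [fnDiff, (chartAt (Eu n) x).left_inv (mem_chart_source _ x), sub_self]

theorem smoothNear_fnDiff (a : C^∞⟮𝓡 n, M; 𝓘(ℝ), ℝ⟯) (x : M) :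
    SmoothNear (fnDiff a x) (chartAt (Eu n) x x) := by
  filter_upwards [(chartAt (Eu n) x).open_target.mem_nhds (mem_chart_target _ x)] with y hy
  have h1 := (contMDiffOn_chart_symm (I := 𝓡 n) (n := ∞) (x := x)).contMDiffAt
    ((chartAt (Eu n) x).open_target.mem_nhds hy)
  exact contDiffAt_const.sub ((a.contMDiff.contMDiffAt).comp y h1).contDiffAt

theorem coord_fnDiff (a : C^∞⟮𝓡 n, M; 𝓘(ℝ), ℝ⟯) (p : Gam n F E G V) (x : M) (s : Sec n F E)
    (t : ℝ) : coord (a x • p - mulBase n F E G V a p) x s t =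
      fun y => fnDiff a x y • coord p x s t y := by
  funext y
  refine (map_sub (fib G V x _) _ _).trans ?_
  rw [fnDiff, sub_smul]
  congr 1
  · exact map_smul (fib G V x _) _ _
  · exact map_smul (fib G V x _) _ _

/-- At a point over `x`, the commutator with `a` is the value on the product with `a(x) - a`, which
vanishes at this point. -/
theorem fnDelta_pt (a : C^∞⟮𝓡 n, M; 𝓘(ℝ), ℝ⟯) (Δ : Gam n F E G₁ V₁ →ₗ[ℝ] Gam n F E G₂ V₂)
    (p : Gam n F E G₁ V₁) (x : M) (s : Sec n F E) (t : ℝ) :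
    (fnDelta a Δ p).1 (pt x s t) = (Δ (a x • p - mulBase n F E G₁ V₁ a p)).1 (pt x s t) := by
  rw [map_sub, map_smul]
  rfl

variable [ContMDiffVectorBundle ∞ F E (𝓡 n)]

theorem smoothNear_jet {k : ℕ} {g : ℝ × Eu n × JetCoord n F k → G} (hg : ContDiff ℝ ∞ g) (x : M)
    (s : Sec n F E) (t : ℝ) : SmoothNear (fun y => g (t, y, jetOf n F k (localRep n F E x s) y))
      (chartAt (Eu n) x x) := by
  filter_upwards [eventually_contDiffAt_localRep s (mem_chart_source (Eu n) x)
    (mem_baseSet_trivializationAt F E x)] with y hy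
  refine hg.contDiffAt.comp _ (contDiffAt_const.prodMk (contDiffAt_id.prodMk
    (contDiffAt_pi.2 fun i => ?_)))
  exact hy.iteratedFDeriv_right (m := ∞) (i := _) le_rfl

theorem smoothNear_coord (p : Gam n F E G V) (x : M) (s : Sec n F E) (t : ℝ) :
    SmoothNear (coord p x s t) (chartAt (Eu n) x x) := by
  obtain ⟨p, k, hp⟩ := p
  obtain ⟨g, hg, h⟩ := hp x
  exact (smoothNear_jet hg x s t).congr (h.eventuallyEq.self_of_nhds s t)

/-- `Δ` has order less than `m` at every point of `ℰ^∞`: `Δ p` vanishes at a point if `p`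
vanishes there to the order `m`. -/
def OrderLT (m : ℕ) (Δ : Gam n F E G₁ V₁ →ₗ[ℝ] Gam n F E G₂ V₂) : Prop :=
  ∀ p x s t, VanishesTo m (coord p x s t) (chartAt (Eu n) x x) → (Δ p).1 (pt x s t) = 0

theorem OrderLT.fnDelta {m : ℕ} {Δ : Gam n F E G₁ V₁ →ₗ[ℝ] Gam n F E G₂ V₂}
    (h : OrderLT (m + 1) Δ) (a : C^∞⟮𝓡 n, M; 𝓘(ℝ), ℝ⟯) : OrderLT m (fnDelta a Δ) := by
  intro p x s t hp
  rw [fnDelta_pt]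
  refine h _ x s t ?_
  rw [coord_fnDiff, add_comm]
  exact (vanishesTo_one (fnDiff_self a x)).smul (smoothNear_fnDiff a x) (smoothNear_coord p x s t) hp

theorem OrderLT.eq_zero {Δ : Gam n F E G₁ V₁ →ₗ[ℝ] Gam n F E G₂ V₂} (h : OrderLT 0 Δ) : Δ = 0 :=
  LinearMap.ext fun p => gam_ext fun x s t => h p x s t (vanishesTo_zero _ _)

/-- The pointwise notion of order implies the algebraic one, with the property `R` of the symbols
coming from their being operators of order zero. -/
theorem OrderLT.hasOrder {l : ℕ} {R : (Gam n F E G₁ V₁ →ₗ[ℝ] Gam n F E G₂ V₂) → Prop}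
    (hR : ∀ Δ, OrderLT 1 Δ → R Δ) {Δ : Gam n F E G₁ V₁ →ₗ[ℝ] Gam n F E G₂ V₂}
    (h : OrderLT (l + 1) Δ) :
    HasOrder (opDelta (mulBase n F E G₁ V₁) (mulBase n F E G₂ V₂)) R l Δ := by
  induction l generalizing Δ with
  | zero => exact ⟨hR _ h, fun a => (h.fnDelta a).eq_zero⟩
  | succ l ih => exact fun a => ih (h.fnDelta a)

/-- The sections that vanish at a point of `ℰ^∞`. -/
def vanishAt (G : Type*) [NormedAddCommGroup G] [NormedSpace ℝ G]
    (V : M → Type*) [TopologicalSpace (TotalSpace G V)] [∀ x, AddCommGroup (V x)]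
    [∀ x, Module ℝ (V x)] [∀ x, TopologicalSpace (V x)] [FiberBundle G V] [VectorBundle ℝ G V]
    (ρ : EInf n F E) : Submodule ℝ (Gam n F E G V) where
  carrier := {p | p.1 ρ = 0}
  zero_mem' := rfl
  add_mem' hp hq := (congrArg₂ (· + ·) hp hq).trans (add_zero _)
  smul_mem' c _ hp := (congrArg (c • ·) hp).trans (smul_zero c)

theorem mem_vanishAt {ρ : EInf n F E} {p : Gam n F E G V} : p ∈ vanishAt G V ρ ↔ p.1 ρ = 0 :=
  Iff.rfl

theorem OrderLT.mem_vanishAt {Δ : Module.End ℝ (Gam n F E G V)} (h : OrderLT 1 Δ)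
    (ρ : EInf n F E) : ∀ q ∈ vanishAt G V ρ, Δ q ∈ vanishAt G V ρ := by
  intro q hq
  rw [EvolEq.mem_vanishAt] at hq ⊢
  rw [← ρ.pt_eta] at hq ⊢
  refine h q _ _ _ (vanishesTo_one ?_)
  exact (coord_self q _ _ _).trans (fib_eq_zero_iff.2 hq)

/-- Operators of order less than `m` in the `i`-th argument are annihilated by `m` commutators in
this argument. -/
theorem word_slot_eq_zero {ι : Type*} [DecidableEq ι] (i : ι) (w : List C^∞⟮𝓡 n, M; 𝓘(ℝ), ℝ⟯) :
    ∀ (A : MultilinearMap ℝ (fun _ : ι => Gam n F E G₁ V₁) (Gam n F E G₂ V₂)),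
      (∀ ξ, OrderLT w.length (A.toLinearMap ξ i)) →
      word (slotDelta (mulBase n F E G₁ V₁) (mulBase n F E G₂ V₂)) (w.map fun c => (i, c)) A = 0 := by
  induction w with
  | nil =>
    intro A hA
    change A = 0
    ext1 ξ
    have h := congrArg (fun T : Gam n F E G₁ V₁ →ₗ[ℝ] Gam n F E G₂ V₂ => T (ξ i)) (hA ξ).eq_zero
    simpa using h
  | cons a w ih =>
    intro A hA
    rw [List.map_cons, word_cons,
      (commute_word (commute_slotDelta commute_mulBase commute_mulBase) _ _).eq,
      Module.End.mul_apply]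
    refine ih _ fun ξ => ?_
    have h : (slotDelta (mulBase n F E G₁ V₁) (mulBase n F E G₂ V₂) (i, a) A).toLinearMap ξ i =
        fnDelta a (A.toLinearMap ξ i) := by
      refine LinearMap.ext fun p => ?_
      have h1 : slotDelta (mulBase n F E G₁ V₁) (mulBase n F E G₂ V₂) (i, a) A
          (Function.update ξ i p) = mulBase n F E G₂ V₂ a (A (Function.update ξ i p)) -
            precomp (Gam n F E G₂ V₂) i (mulBase n F E G₁ V₁ a) A (Function.update ξ i p) := rfl
      rw [precomp_apply, Function.update_self, Function.update_idem] at h1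
      exact h1
    rw [h]
    exact (hA ξ).fnDelta a

/-- A `𝒞`-differential operator is linear and its order is seen at each point. -/
theorem IsCDiffOfOrder.exists_linearMap {l : ℕ} {Δ : Gam n F E G₁ V₁ → Gam n F E G₂ V₂}
    (h : IsCDiffOfOrder l Δ) :
    ∃ T : Gam n F E G₁ V₁ →ₗ[ℝ] Gam n F E G₂ V₂, (∀ p, T p = Δ p) ∧ OrderLT (l + 1) T := by
  obtain ⟨k, h⟩ := h
  have key : ∀ (x : M) (s : Sec n F E) (t : ℝ),
      ∃ a : (i : Fin (l + 1)) → (Fin i → Fin n) → (G₁ →L[ℝ] G₂), ∀ p,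
        fib G₂ V₂ x x ((Δ p).1 (pt x s t)) =
          ∑ i, ∑ σ, a i σ (pderiv σ (coord p x s t) (chartAt (Eu n) x x)) := by
    intro x s t
    obtain ⟨a, _, ha⟩ := h x
    exact ⟨_, fun p => ha.self_of_nhds p s t⟩
  refine ⟨{ toFun := Δ, map_add' := fun p q => ?_, map_smul' := fun c p => ?_ }, fun _ => rfl, ?_⟩
  · refine gam_ext fun x s t => fib_injective (G := G₂) (V := V₂) x ?_
    obtain ⟨a, ha⟩ := key x s t
    refine (ha _).trans (Eq.trans ?_ (map_add (fib G₂ V₂ x x) _ _).symm)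
    rw [ha, ha, ← Finset.sum_add_distrib]
    refine Finset.sum_congr rfl fun i _ => ?_
    rw [← Finset.sum_add_distrib]
    refine Finset.sum_congr rfl fun σ _ => ?_
    rw [coord_add, pderiv_add σ (smoothNear_coord p x s t) (smoothNear_coord q x s t), map_add]
  · refine gam_ext fun x s t => fib_injective (G := G₂) (V := V₂) x ?_
    obtain ⟨a, ha⟩ := key x s t
    refine (ha _).trans (Eq.trans ?_ (map_smul (fib G₂ V₂ x x) _ _).symm)
    rw [ha, Finset.smul_sum]
    refine Finset.sum_congr rfl fun i _ => ?_
    rw [Finset.smul_sum]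
    refine Finset.sum_congr rfl fun σ _ => ?_
    rw [coord_smul, pderiv_const_smul σ (smoothNear_coord p x s t), map_smul]
    rfl
  · intro p x s t hp
    obtain ⟨a, ha⟩ := key x s t
    refine fib_eq_zero_iff.1 ((ha p).trans ?_)
    refine Finset.sum_eq_zero fun i _ => Finset.sum_eq_zero fun σ _ => ?_
    rw [hp.pderiv_eq_zero i.2, map_zero]

end Pointwise

/-! ### The total derivative in time and the adjoint -/

section TotalDerivative

variable {n : ℕ} {M : Type*} [TopologicalSpace M] [ChartedSpace (Eu n) M] [IsManifold (𝓡 n) ∞ M]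
  {F : Type*} [NormedAddCommGroup F] [NormedSpace ℝ F]
  {E : M → Type*} [TopologicalSpace (TotalSpace F E)] [∀ x, AddCommGroup (E x)]
  [∀ x, Module ℝ (E x)] [∀ x, TopologicalSpace (E x)] [FiberBundle F E] [VectorBundle ℝ F E]
  {G : Type*} [NormedAddCommGroup G] [NormedSpace ℝ G]
  {V : M → Type*} [TopologicalSpace (TotalSpace G V)] [∀ x, AddCommGroup (V x)]
  [∀ x, Module ℝ (V x)] [∀ x, TopologicalSpace (V x)] [FiberBundle G V] [VectorBundle ℝ G V]
  {G₁ : Type*} [NormedAddCommGroup G₁] [NormedSpace ℝ G₁]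
  {V₁ : M → Type*} [TopologicalSpace (TotalSpace G₁ V₁)] [∀ x, AddCommGroup (V₁ x)]
  [∀ x, Module ℝ (V₁ x)] [∀ x, TopologicalSpace (V₁ x)] [FiberBundle G₁ V₁] [VectorBundle ℝ G₁ V₁]
  {G₂ : Type*} [NormedAddCommGroup G₂] [NormedSpace ℝ G₂]
  {V₂ : M → Type*} [TopologicalSpace (TotalSpace G₂ V₂)] [∀ x, AddCommGroup (V₂ x)]
  [∀ x, Module ℝ (V₂ x)] [∀ x, TopologicalSpace (V₂ x)] [FiberBundle G₂ V₂] [VectorBundle ℝ G₂ V₂]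

variable [ContMDiffVectorBundle ∞ F E (𝓡 n)]

theorem fib_fibDeriv_self (x : M) (c : ℝ → V x) (τ : ℝ) :
    fib G V x x (fibDeriv G V x c τ) = deriv (fun τ' => fib G V x x (c τ')) τ :=
  (trivializationAt G V x).continuousLinearMapAt_symmL (R := ℝ)
    (mem_baseSet_trivializationAt G V x) _

theorem differentiableAt_time (p : Gam n F E G V) (x : M) (s : Sec n F E) (t : ℝ) :
    DifferentiableAt ℝ (fun τ => fib G V x x (p.1 (pt x s τ))) t := by
  obtain ⟨p, k, hp⟩ := p
  obtain ⟨g, hg, h⟩ := hp x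
  have h1 : (fun τ => fib G V x x (p (pt x s τ))) = fun τ => g (τ, chartAt (Eu n) x x,
      jetOf n F k (localRep n F E x s) (chartAt (Eu n) x x)) :=
    funext fun τ => h.self_of_nhds s τ
  change DifferentiableAt ℝ (fun τ => fib G V x x (p (pt x s τ))) t
  rw [h1]
  exact (hg.comp (contDiff_id.prodMk contDiff_const)).contDiffAt.differentiableAt (by simp)

/-- The jets depend linearly on the section, so the derivative along a deformation `s + ε σ` is a
derivative in the coordinates of the jet space. -/
theorem jetOf_add_smul (k : ℕ) (x : M) (s σ : Sec n F E) (ε : ℝ) :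
    jetOf n F k (localRep n F E x (s + ε • σ : Sec n F E)) (chartAt (Eu n) x x) =
      jetOf n F k (localRep n F E x s) (chartAt (Eu n) x x) +
        ε • jetOf n F k (localRep n F E x σ) (chartAt (Eu n) x x) := by
  have hs : ∀ s : Sec n F E, SmoothNear (localRep n F E x s) (chartAt (Eu n) x x) := fun s =>
    eventually_contDiffAt_localRep s (mem_chart_source (Eu n) x) (mem_baseSet_trivializationAt F E x)
  have e : localRep n F E x (s + ε • σ : Sec n F E) =
      localRep n F E x s + ε • localRep n F E x σ := by
    funext z
    simp [localRep]
  funext i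
  simp only [jetOf, Pi.add_apply, Pi.smul_apply]
  rw [e]
  refine (iteratedFDeriv_add_apply (hs s).contDiffAt ((hs σ).const_smul ε).contDiffAt).trans ?_
  rw [iteratedFDeriv_const_smul_apply (hs σ).contDiffAt]

theorem differentiableAt_deformation (p : Gam n F E G V) (x : M) (s σ : Sec n F E) (t : ℝ) :
    DifferentiableAt ℝ (fun ε : ℝ => fib G V x x (p.1 (pt x (s + ε • σ) t))) 0 := by
  obtain ⟨p, k, hp⟩ := p
  obtain ⟨g, hg, h⟩ := hp x
  have h1 : (fun ε : ℝ => fib G V x x (p (pt x (s + ε • σ) t))) = fun ε => g (t,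
      chartAt (Eu n) x x, jetOf n F k (localRep n F E x s) (chartAt (Eu n) x x) +
        ε • jetOf n F k (localRep n F E x σ) (chartAt (Eu n) x x)) := by
    funext ε
    rw [← jetOf_add_smul]
    exact h.self_of_nhds _ t
  change DifferentiableAt ℝ (fun ε : ℝ => fib G V x x (p (pt x (s + ε • σ) t))) 0
  rw [h1]
  exact (hg.comp (contDiff_const.prodMk (contDiff_const.prodMk (contDiff_const.add
    (contDiff_id.smul contDiff_const))))).contDiffAt.differentiableAt (by simp)

theorem fib_totalT (f : Gam n F E F E) (p : Gam n F E G V) (x : M) (s : Sec n F E) (t : ℝ) :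
    fib G V x x ((totalT f p).1 (pt x s t)) =
      deriv (fun τ => fib G V x x (p.1 (pt x s τ))) t +
        deriv (fun ε : ℝ => fib G V x x (p.1 (pt x (s + ε • along f s t) t))) 0 := by
  have h1 : (totalT f p).1 (pt x s t) = fibDeriv G V x (fun τ => p.1 (pt x s τ)) t +
      fibDeriv G V x (fun ε => p.1 (pt x (s + ε • along f s t) t)) 0 :=
    congrArg (fun v : V x => fibDeriv G V x (fun τ => p.1 (pt x s τ)) t + v) (lin_pt p f x s t)
  exact (congrArg (fib G V x x) h1).trans ((map_add (fib G V x x) _ _).trans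
    (congrArg₂ (· + ·) (fib_fibDeriv_self x _ t) (fib_fibDeriv_self x _ 0)))

theorem totalT_add (f : Gam n F E F E) (p q : Gam n F E G V) :
    totalT f (p + q) = totalT f p + totalT f q := by
  refine gam_ext fun x s t => fib_injective (G := G) (V := V) x ?_
  refine (fib_totalT f _ x s t).trans (Eq.trans ?_ (map_add (fib G V x x) _ _).symm)
  rw [fib_totalT, fib_totalT]
  have e1 : (fun τ => fib G V x x ((p + q).1 (pt x s τ))) =
      (fun τ => fib G V x x (p.1 (pt x s τ))) + fun τ => fib G V x x (q.1 (pt x s τ)) :=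
    funext fun τ => map_add (fib G V x x) _ _
  have e2 : (fun ε : ℝ => fib G V x x ((p + q).1 (pt x (s + ε • along f s t) t))) =
      (fun ε : ℝ => fib G V x x (p.1 (pt x (s + ε • along f s t) t))) +
        fun ε : ℝ => fib G V x x (q.1 (pt x (s + ε • along f s t) t)) :=
    funext fun τ => map_add (fib G V x x) _ _
  rw [e1, e2, deriv_add (differentiableAt_time p x s t) (differentiableAt_time q x s t),
    deriv_add (differentiableAt_deformation p x s _ t) (differentiableAt_deformation q x s _ t)]
  abel

theorem totalT_smulBase (f : Gam n F E F E) (a : C^∞⟮𝓡 n, M; 𝓘(ℝ), ℝ⟯) (p : Gam n F E G V) :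
    totalT f (smulBase a p) = smulBase a (totalT f p) := by
  refine gam_ext fun x s t => fib_injective (G := G) (V := V) x ?_
  refine (fib_totalT f _ x s t).trans (Eq.trans ?_ (map_smul (fib G V x x) (a x) _).symm)
  rw [fib_totalT]
  have e1 : (fun τ => fib G V x x ((smulBase a p).1 (pt x s τ))) =
      a x • fun τ => fib G V x x (p.1 (pt x s τ)) :=
    funext fun τ => map_smul (fib G V x x) (a x) _
  have e2 : (fun ε : ℝ => fib G V x x ((smulBase a p).1 (pt x (s + ε • along f s t) t))) =
      a x • fun ε : ℝ => fib G V x x (p.1 (pt x (s + ε • along f s t) t)) :=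
    funext fun τ => map_smul (fib G V x x) (a x) _
  rw [e1, e2, deriv_const_smul _ (differentiableAt_time p x s t),
    deriv_const_smul _ (differentiableAt_deformation p x s _ t), smul_add]

/-- The constant function `c` on `M`. -/
noncomputable def constFn (c : ℝ) : C^∞⟮𝓡 n, M; 𝓘(ℝ), ℝ⟯ := ⟨fun _ => c, contMDiff_const⟩

/-- The total derivative `D_t` as a linear map. -/
noncomputable def totalTLin (f : Gam n F E F E) : Module.End ℝ (Gam n F E G V) where
  toFun := totalT f
  map_add' := totalT_add f
  map_smul' c p := totalT_smulBase f (constFn c) p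

/-- `D_t` commutes with the multiplication by functions on `M`. -/
theorem fnDelta_totalTLin (f : Gam n F E F E) (a : C^∞⟮𝓡 n, M; 𝓘(ℝ), ℝ⟯) :
    fnDelta a (totalTLin f : Module.End ℝ (Gam n F E G V)) = 0 :=
  LinearMap.ext fun p => sub_eq_zero.2 (totalT_smulBase f a p).symm

/-- An operator and its adjoint in the coordinates around a point. -/
theorem IsAdjoint.exists_coeff {l : ℕ} {Δ : Gam n F E G₁ V₁ → Gam n F E G₂ V₂}
    {Δ' : Gam n F E (HatModel n G₂) (Hat n V₂) → Gam n F E (HatModel n G₁) (Hat n V₁)}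
    (h : IsAdjoint Δ Δ') (hΔ : IsCDiffOfOrder l Δ) (x : M) (s : Sec n F E) (t : ℝ) :
    ∃ a : (i : Fin (l + 1)) → (Fin i → Fin n) → Eu n → (G₁ →L[ℝ] G₂),
      (∀ i σ, SmoothNear (a i σ) (chartAt (Eu n) x x)) ∧
      (∀ p, fib G₂ V₂ x x ((Δ p).1 (pt x s t)) = ∑ i, ∑ σ,
        a i σ (chartAt (Eu n) x x) (pderiv σ (coord p x s t) (chartAt (Eu n) x x))) ∧
      (∀ q, fib (HatModel n G₁) (Hat n V₁) x x ((Δ' q).1 (pt x s t)) =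
        ∑ i : Fin (l + 1), ∑ σ, (-1 : ℝ) ^ (i : ℕ) • pderiv σ
          (fun y => (coord q x s t y).comp (a i σ y)) (chartAt (Eu n) x x)) := by
  obtain ⟨k, hk⟩ := hΔ
  obtain ⟨a, ha⟩ := hk x
  exact ⟨fun i σ y => a i σ (t, y, jetOf n F k (localRep n F E x s) y),
    fun i σ => smoothNear_jet (ha.1 i σ) x s t, fun p => ha.2.self_of_nhds p s t,
    fun q => (h.2 x l k a ha).self_of_nhds q s t⟩

/-- The adjoint is linear and, at each point, its order is at most that of the operator. -/
theorem IsAdjoint.exists_linearMap {l : ℕ} {Δ : Gam n F E G₁ V₁ → Gam n F E G₂ V₂}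
    {Δ' : Gam n F E (HatModel n G₂) (Hat n V₂) → Gam n F E (HatModel n G₁) (Hat n V₁)}
    (h : IsAdjoint Δ Δ') (hΔ : IsCDiffOfOrder l Δ) :
    ∃ T : Gam n F E (HatModel n G₂) (Hat n V₂) →ₗ[ℝ] Gam n F E (HatModel n G₁) (Hat n V₁),
      (∀ p, T p = Δ' p) ∧ OrderLT (l + 1) T := by
  refine ⟨{ toFun := Δ', map_add' := fun p q => ?_, map_smul' := fun c p => ?_ }, fun _ => rfl, ?_⟩
  · refine gam_ext fun x s t => fib_injective (G := HatModel n G₁) (V := Hat n V₁) x ?_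
    obtain ⟨a, has, -, ha⟩ := h.exists_coeff hΔ x s t
    refine (ha _).trans (Eq.trans ?_ (map_add (fib (HatModel n G₁) (Hat n V₁) x x) _ _).symm)
    rw [ha, ha, ← Finset.sum_add_distrib]
    refine Finset.sum_congr rfl fun i _ => ?_
    rw [← Finset.sum_add_distrib]
    refine Finset.sum_congr rfl fun σ _ => ?_
    have hs := fun p : Gam n F E (HatModel n G₂) (Hat n V₂) => (smoothNear_coord p x s t).bilinear
      (ContinuousLinearMap.compL ℝ G₁ G₂ (TopModel n)) (has i σ)
    rw [← smul_add]
    congr 1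
    refine Eq.trans ?_ (pderiv_add σ (hs p) (hs q))
    congr 1
    rw [coord_add]
    funext y
    exact ContinuousLinearMap.add_comp _ _ _
  · refine gam_ext fun x s t => fib_injective (G := HatModel n G₁) (V := Hat n V₁) x ?_
    obtain ⟨a, has, -, ha⟩ := h.exists_coeff hΔ x s t
    refine (ha _).trans (Eq.trans ?_ (map_smul (fib (HatModel n G₁) (Hat n V₁) x x) c _).symm)
    rw [ha, Finset.smul_sum]
    refine Finset.sum_congr rfl fun i _ => ?_
    rw [Finset.smul_sum]
    refine Finset.sum_congr rfl fun σ _ => ?_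
    have hs := (smoothNear_coord p x s t).bilinear
      (ContinuousLinearMap.compL ℝ G₁ G₂ (TopModel n)) (has i σ)
    rw [smul_comm]
    congr 1
    refine Eq.trans ?_ (pderiv_const_smul σ hs c)
    congr 1
    rw [coord_smul]
    funext y
    exact ContinuousLinearMap.smul_comp _ _ _
  · intro p x s t hp
    obtain ⟨a, has, -, ha⟩ := h.exists_coeff hΔ x s t
    refine fib_eq_zero_iff.1 ((ha p).trans ?_)
    refine Finset.sum_eq_zero fun i _ => Finset.sum_eq_zero fun σ _ => ?_
    have hv := VanishesTo.bilinear (ContinuousLinearMap.compL ℝ G₁ G₂ (TopModel n))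
      (smoothNear_coord p x s t) (has i σ) hp (vanishesTo_zero _ _)
    have hz : pderiv σ (fun y => (coord p x s t y).comp (a i σ y)) (chartAt (Eu n) x x) = 0 :=
      hv.pderiv_eq_zero i.2 σ
    rw [hz, smul_zero]

/-- At a point over `x`, the `m`-fold commutator of an operator with `a` is its value on the
product with `(a(x) - a)^m`. -/
theorem exists_fnDelta_iterate (a : C^∞⟮𝓡 n, M; 𝓘(ℝ), ℝ⟯) (m : ℕ)
    (Δ : Gam n F E G₁ V₁ →ₗ[ℝ] Gam n F E G₂ V₂) (p : Gam n F E G₁ V₁) (x : M) (s : Sec n F E)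
    (t : ℝ) : ∃ q, ((fnDelta a)^[m] Δ p).1 (pt x s t) = (Δ q).1 (pt x s t) ∧
      coord q x s t = fun y => fnDiff a x y ^ m • coord p x s t y := by
  induction m generalizing Δ with
  | zero => exact ⟨p, rfl, by simp⟩
  | succ m ih =>
    obtain ⟨q, h1, h2⟩ := ih (fnDelta a Δ)
    refine ⟨a x • q - mulBase n F E G₁ V₁ a q, ?_, ?_⟩
    · rw [Function.iterate_succ_apply, h1, fnDelta_pt]
    · rw [coord_fnDiff, h2]
      funext y
      rw [smul_smul, pow_succ']

/-- The top symbols of an operator and of its adjoint are transposed to each other, up to a sign. -/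
theorem IsAdjoint.exists_symbol {l : ℕ} {Δ : Gam n F E G₁ V₁ →ₗ[ℝ] Gam n F E G₂ V₂}
    {Δ' : Gam n F E (HatModel n G₂) (Hat n V₂) →ₗ[ℝ] Gam n F E (HatModel n G₁) (Hat n V₁)}
    (h : IsAdjoint Δ Δ') (hΔ : IsCDiffOfOrder l Δ) (a : C^∞⟮𝓡 n, M; 𝓘(ℝ), ℝ⟯) (x : M)
    (s : Sec n F E) (t : ℝ) : ∃ S : G₁ →L[ℝ] G₂,
      (∀ p, fib G₂ V₂ x x (((fnDelta a)^[l] Δ p).1 (pt x s t)) =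
        S (fib G₁ V₁ x x (p.1 (pt x s t)))) ∧
      (∀ q, fib (HatModel n G₁) (Hat n V₁) x x (((fnDelta a)^[l] Δ' q).1 (pt x s t)) =
        (-1 : ℝ) ^ l • (fib (HatModel n G₂) (Hat n V₂) x x (q.1 (pt x s t))).comp S) := by
  obtain ⟨b, hbs, hb, hb'⟩ := h.exists_coeff hΔ x s t
  set y₀ := chartAt (Eu n) x x with hy₀
  have hh := smoothNear_fnDiff a x
  have h0 := fnDiff_self a x
  refine ⟨∑ σ : Fin ((Fin.last l : Fin (l + 1)) : ℕ) → Fin n,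
    pderiv σ (fun z => fnDiff a x z ^ l) y₀ • b (Fin.last l) σ y₀, fun p => ?_, fun q => ?_⟩
  · obtain ⟨p', h1, h2⟩ := exists_fnDelta_iterate a l Δ p x s t
    refine (congrArg (fib G₂ V₂ x x) h1).trans ((hb p').trans ?_)
    have hv := (VanishesTo.pow hh h0 l).smul (hh.pow l) (smoothNear_coord p x s t)
      (vanishesTo_zero _ _)
    rw [Fin.sum_univ_castSucc, Finset.sum_eq_zero fun i _ => Finset.sum_eq_zero fun σ _ => ?_,
      zero_add, sum_apply]
    · refine Finset.sum_congr rfl fun σ _ => ?_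
      rw [h2, ← coord_self, smul_apply, ← map_smul]
      congr 1
      exact pderiv_pow_smul σ hh h0 (smoothNear_coord p x s t)
    · rw [h2, hv.pderiv_eq_zero i.2, map_zero]
  · obtain ⟨q', h1, h2⟩ := exists_fnDelta_iterate a l Δ' q x s t
    refine (congrArg (fib (HatModel n G₁) (Hat n V₁) x x) h1).trans ((hb' q').trans ?_)
    have hs : ∀ i σ, SmoothNear (fun y => (coord q x s t y).comp (b i σ y)) y₀ := fun i σ =>
      (smoothNear_coord q x s t).bilinear (ContinuousLinearMap.compL ℝ G₁ G₂ (TopModel n)) (hbs i σ)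
    have hc : ∀ i σ, (fun y => (coord q' x s t y).comp (b i σ y)) =
        fun y => fnDiff a x y ^ l • (coord q x s t y).comp (b i σ y) := fun i σ => by
      funext y
      rw [h2]
      exact ContinuousLinearMap.smul_comp _ _ _
    rw [Fin.sum_univ_castSucc, Finset.sum_eq_zero fun i _ => Finset.sum_eq_zero fun σ _ => ?_,
      zero_add, ← Finset.smul_sum]
    · refine congrArg (fun T : G₁ →L[ℝ] TopModel n => (-1 : ℝ) ^ l • T) ?_
      rw [ContinuousLinearMap.comp_finsetSum]
      refine Finset.sum_congr rfl fun σ _ => ?_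
      rw [hc, ← coord_self, ContinuousLinearMap.comp_smul]
      exact pderiv_pow_smul σ hh h0 (hs _ σ)
    · have hv := (VanishesTo.pow hh h0 l).smul (hh.pow l) (hs i.castSucc σ) (vanishesTo_zero _ _)
      rw [hc, hv.pderiv_eq_zero i.2, smul_zero]

end TotalDerivative

/-! ### Smoothness of the bundle of forms of top degree -/

section TopForms

theorem contDiff_det (n : ℕ) :
    ContDiff ℝ ∞ fun f : Eu n →L[ℝ] Eu n => LinearMap.det (f : Eu n →ₗ[ℝ] Eu n) := by
  let b := (EuclideanSpace.basisFun (Fin n) ℝ).toBasis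
  have h : ∀ i j, ContDiff ℝ ∞ fun f : Eu n →L[ℝ] Eu n =>
      LinearMap.toMatrix b b (f : Eu n →ₗ[ℝ] Eu n) i j := fun i j => by
    simp only [LinearMap.toMatrix_apply, b]
    exact (EuclideanSpace.proj i : Eu n →L[ℝ] ℝ).contDiff.comp
      (contDiff_id.clm_apply contDiff_const)
  simp only [← LinearMap.det_toMatrix b, Matrix.det_apply]
  refine ContDiff.sum fun σ _ => ContDiff.const_smul _ (contDiff_prod fun i _ => h _ _)

/-- A form of top degree pulls back along an endomorphism by the determinant. -/
theorem topForm_comp {n : ℕ} (θ : Eu n [⋀^Fin n]→L[ℝ] ℝ) (f : Eu n →ₗ[ℝ] Eu n) (v : Fin n → Eu n) :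
    θ (fun i => f (v i)) = LinearMap.det f * θ v := by
  let b := (EuclideanSpace.basisFun (Fin n) ℝ).toBasis
  have h : ∀ w : Fin n → Eu n, θ w = θ b * b.det w := fun w =>
    congrArg (fun T : Eu n [⋀^Fin n]→ₗ[ℝ] ℝ => T w) (θ.toAlternatingMap.eq_smul_basis_det b)
  rw [h, h v]
  have := b.det_comp f v
  rw [Function.comp_def] at this
  rw [this]
  ring

variable {n : ℕ} {M : Type*} [TopologicalSpace M] [ChartedSpace (Eu n) M] [IsManifold (𝓡 n) ∞ M]

/-- The bundle of forms of top degree is smooth: its transition functions are multiplications by the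
determinants of those of the tangent bundle. -/
instance : ContMDiffVectorBundle ∞ (TopModel n) (Top n M) (𝓡 n) := by
  have hp : (Bundle.ContinuousAlternatingMap.vectorPrebundle ℝ (Fin n) (Eu n)
      (TangentSpace (𝓡 n) : M → Type _) ℝ (Bundle.Trivial M ℝ)).IsContMDiff (𝓡 n) ∞ := by
    constructor
    rintro _ ⟨e₁, e₂, he₁, he₂, rfl⟩ _ ⟨e₁', e₂', he₁', he₂', rfl⟩
    refine ⟨Pretrivialization.continuousAlternatingMapCoordChange ℝ (Fin n) e₁ e₁' e₂ e₂', ?_,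
      Pretrivialization.continuousAlternatingMapCoordChange_apply⟩
    have h1 := contMDiffOn_coordChangeL (IB := 𝓡 n) (n := ∞) e₁' e₁
    have h2 := contMDiffOn_coordChangeL (IB := 𝓡 n) (n := ∞) e₂ e₂'
    have h3 : ∀ b, (Pretrivialization.continuousAlternatingMapCoordChange ℝ (Fin n) e₁ e₁' e₂ e₂' b) =
        ((e₂.coordChangeL ℝ e₂' b : ℝ →L[ℝ] ℝ) 1 *
          LinearMap.det ((e₁'.coordChangeL ℝ e₁ b : Eu n →L[ℝ] Eu n) : Eu n →ₗ[ℝ] Eu n)) •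
          ContinuousLinearMap.id ℝ (Eu n [⋀^Fin n]→L[ℝ] ℝ) := by
      intro b
      ext θ v
      change (e₂.coordChangeL ℝ e₂' b : ℝ →L[ℝ] ℝ)
        (θ fun i => (e₁'.coordChangeL ℝ e₁ b).symm.symm (v i)) = _
      have h4 := topForm_comp θ
        ((e₁'.coordChangeL ℝ e₁ b : Eu n →L[ℝ] Eu n) : Eu n →ₗ[ℝ] Eu n) v
      have h5 : ∀ (T : ℝ →L[ℝ] ℝ) (r : ℝ), T r = T 1 * r := fun T r => by
        conv_lhs => rw [← mul_one r, ← smul_eq_mul, map_smul, smul_eq_mul, mul_comm]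
      refine (congrArg (e₂.coordChangeL ℝ e₂' b : ℝ →L[ℝ] ℝ) h4).trans ?_
      rw [h5]
      exact (mul_assoc _ _ _).symm
    refine ContMDiffOn.congr ?_ fun b _ => h3 b
    have h4 := ((ContinuousLinearMap.apply ℝ ℝ (1 : ℝ)).contDiff.contMDiff.comp_contMDiffOn h2).mono
      (t := (e₁.baseSet ∩ e₂.baseSet) ∩ (e₁'.baseSet ∩ e₂'.baseSet)) fun b hb => ⟨hb.1.2, hb.2.2⟩
    have h5 := ((contDiff_det n).contMDiff.comp_contMDiffOn h1).mono
      (t := (e₁.baseSet ∩ e₂.baseSet) ∩ (e₁'.baseSet ∩ e₂'.baseSet)) fun b hb => ⟨hb.2.1, hb.1.1⟩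
    exact (ContMDiffOn.mul h4 h5).smul contMDiffOn_const
  exact (Bundle.ContinuousAlternatingMap.vectorPrebundle ℝ (Fin n) (Eu n)
      (TangentSpace (𝓡 n) : M → Type _) ℝ (Bundle.Trivial M ℝ)).contMDiffVectorBundle (𝓡 n)

end TopForms

/-! ### Sections with prescribed values and density -/

section Extension

variable {n : ℕ} {M : Type*} [TopologicalSpace M] [ChartedSpace (Eu n) M] [IsManifold (𝓡 n) ∞ M]
  {F : Type*} [NormedAddCommGroup F] [NormedSpace ℝ F]
  {E : M → Type*} [TopologicalSpace (TotalSpace F E)] [∀ x, AddCommGroup (E x)]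
  [∀ x, Module ℝ (E x)] [∀ x, TopologicalSpace (E x)] [FiberBundle F E] [VectorBundle ℝ F E]
  {G : Type*} [NormedAddCommGroup G] [NormedSpace ℝ G]
  {V : M → Type*} [TopologicalSpace (TotalSpace G V)] [∀ x, AddCommGroup (V x)]
  [∀ x, Module ℝ (V x)] [∀ x, TopologicalSpace (V x)] [FiberBundle G V] [VectorBundle ℝ G V]

/-- A function that is smooth near a point agrees near this point with a globally smooth one. -/
theorem exists_contDiff_extension {h : Eu n → G} {y₀ : Eu n} (hh : SmoothNear h y₀) :
    ∃ H : Eu n → G, ContDiff ℝ ∞ H ∧ H =ᶠ[𝓝 y₀] h := by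
  obtain ⟨ε, hε, hb⟩ := Metric.eventually_nhds_iff_ball.1 hh
  let b : ContDiffBump y₀ := ⟨ε / 4, ε / 2, by positivity, by linarith⟩
  refine ⟨fun y => b y • h y, ?_, ?_⟩
  · rw [contDiff_iff_contDiffAt]
    intro y
    by_cases hy : y ∈ tsupport b
    · have : y ∈ Metric.ball y₀ ε := by
        rw [b.tsupport_eq] at hy
        have := Metric.mem_closedBall.1 hy
        simp only [b] at this
        exact Metric.mem_ball.2 (by linarith)
      exact b.contDiff.contDiffAt.smul (hb y this)
    · have h0 : b =ᶠ[𝓝 y] 0 := notMem_tsupport_iff_eventuallyEq.1 hy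
      refine (contDiffAt_const (c := (0 : G))).congr_of_eventuallyEq ?_
      filter_upwards [h0] with z hz
      simp [hz]
  · filter_upwards [b.eventuallyEq_one] with y hy
    simp [hy]

/-- A function that is smooth near `x₁` is the restriction of a globally defined smooth function of
the coordinates. -/
theorem exists_contDiff_chart {Ψ : M → G} {x₁ : M}
    (h : ∀ᶠ x in 𝓝 x₁, ContMDiffAt (𝓡 n) 𝓘(ℝ, G) ∞ Ψ x) :
    ∃ H : Eu n → G, ContDiff ℝ ∞ H ∧ ∀ᶠ x in 𝓝 x₁, H (chartAt (Eu n) x₁ x) = Ψ x := by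
  have hs := mem_chart_source (Eu n) x₁
  have hc := (chartAt (Eu n) x₁).continuousAt_symm ((chartAt (Eu n) x₁).map_source hs)
  rw [ContinuousAt, (chartAt (Eu n) x₁).left_inv hs] at hc
  have hsm : SmoothNear (fun y => Ψ ((chartAt (Eu n) x₁).symm y)) (chartAt (Eu n) x₁ x₁) := by
    filter_upwards [hc.eventually h,
      (chartAt (Eu n) x₁).open_target.mem_nhds (mem_chart_target _ x₁)] with y h1 hy
    have h2 := (contMDiffOn_chart_symm (I := 𝓡 n) (n := ∞) (x := x₁)).contMDiffAt
      ((chartAt (Eu n) x₁).open_target.mem_nhds hy)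
    exact (h1.comp y h2).contDiffAt
  obtain ⟨H, hH, he⟩ := exists_contDiff_extension hsm
  refine ⟨H, hH, ?_⟩
  filter_upwards [((chartAt (Eu n) x₁).continuousAt hs).eventually he,
    (chartAt (Eu n) x₁).open_source.mem_nhds hs] with x h1 h2
  rw [h1, (chartAt (Eu n) x₁).left_inv h2]

/-- The transition function between two trivializations, cut off so that it is smooth also where one
of them is not defined. -/
theorem contMDiffAt_bump_transition [ContMDiffVectorBundle ∞ G V (𝓡 n)]
    (e e' : Trivialization G (TotalSpace.proj : TotalSpace G V → M)) [MemTrivializationAtlas e]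
    [MemTrivializationAtlas e'] {χ : M → ℝ} (hχ : ContMDiff (𝓡 n) 𝓘(ℝ) ∞ χ) {x₁ : M}
    (h : x₁ ∈ tsupport χ → x₁ ∈ e.baseSet ∧ x₁ ∈ e'.baseSet) :
    ∀ᶠ x in 𝓝 x₁, ContMDiffAt (𝓡 n) 𝓘(ℝ, G →L[ℝ] G) ∞
      (fun x => χ x • (e'.continuousLinearMapAt ℝ x).comp (e.symmL ℝ x)) x := by
  by_cases hx : x₁ ∈ tsupport χ
  · have ho := (e.open_baseSet.inter e'.open_baseSet).mem_nhds (h hx)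
    filter_upwards [ho] with x hx
    refine (hχ.contMDiffAt.smul
      (contMDiffAt_coordChangeL (IB := 𝓡 n) (n := ∞) hx.1 hx.2)).congr_of_eventuallyEq ?_
    filter_upwards [(e.open_baseSet.inter e'.open_baseSet).mem_nhds hx] with z hz
    refine congrArg (χ z • ·) ?_
    ext v
    refine Eq.trans ?_ (e.coordChangeL_apply e' hz v).symm
    rw [ContinuousLinearMap.comp_apply, e'.continuousLinearMapAt_apply_of_mem ℝ hz.2,
      e.symmL_apply hz.1]
  · filter_upwards [(isClosed_tsupport χ).isOpen_compl.mem_nhds hx] with x hx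
    refine (contMDiffAt_const (c := (0 : G →L[ℝ] G))).congr_of_eventuallyEq ?_
    filter_upwards [notMem_tsupport_iff_eventuallyEq.1 hx] with z hz
    rw [hz]
    exact zero_smul _ _

variable [T2Space M]

theorem exists_bump (x₀ : M) {s : Set M} (hs : s ∈ 𝓝 x₀) :
    ∃ χ : M → ℝ, ContMDiff (𝓡 n) 𝓘(ℝ) ∞ χ ∧ χ x₀ = 1 ∧ tsupport χ ⊆ s := by
  obtain ⟨χ, -, hχ⟩ := (SmoothBumpFunction.nhds_basis_tsupport (I := 𝓡 n) x₀).mem_iff.1 hs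
  exact ⟨χ, χ.contMDiff, χ.eq_one, hχ⟩

/-- There are sections with a prescribed value at a point. -/
theorem exists_gam_apply_eq [ContMDiffVectorBundle ∞ G V (𝓡 n)] (ρ : EInf n F E) (v : V ρ.base) :
    ∃ p : Gam n F E G V, p.1 ρ = v := by
  set e := trivializationAt G V ρ.base with he
  obtain ⟨χ, hχ, h1, hs⟩ := exists_bump (n := n) ρ.base
    (e.open_baseSet.mem_nhds (mem_baseSet_trivializationAt G V ρ.base))
  refine ⟨⟨fun ρ' => χ ρ'.base • e.symmL ℝ ρ'.base (fib G V ρ.base ρ.base v), 0, fun x₁ => ?_⟩, ?_⟩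
  · obtain ⟨H, hH, h2⟩ := exists_contDiff_chart (contMDiffAt_bump_transition e
      (trivializationAt G V x₁) hχ fun h => ⟨hs h, mem_baseSet_trivializationAt G V x₁⟩)
    refine ⟨fun z => H z.2.1 (fib G V ρ.base ρ.base v), ?_, ?_⟩
    · exact (hH.comp (contDiff_fst.comp contDiff_snd)).clm_apply contDiff_const
    · filter_upwards [h2] with x h2 s t
      rw [h2]
      exact map_smul (fib G V x₁ x) _ _
  · change χ ρ.base • e.symmL ℝ ρ.base (fib G V ρ.base ρ.base v) = v
    rw [h1, one_smul]
    exact e.symmL_continuousLinearMapAt (R := ℝ) (mem_baseSet_trivializationAt G V ρ.base) v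

/-- A section that vanishes on a dense subset of `ℰ^∞` is zero. -/
theorem eq_zero_of_dense [ContMDiffVectorBundle ∞ G V (𝓡 n)] {U : Set (EInf n F E)} (hU : Dense U)
    {p : Gam n F E G V} (hp : ∀ ρ ∈ U, p.1 ρ = 0) : p = 0 := by
  refine Subtype.ext (funext fun ρ => ?_)
  change p.1 ρ = 0
  by_contra hne
  set x₀ := ρ.base with hx₀
  set e := trivializationAt G V x₀ with he
  obtain ⟨χ, hχ, h1, hs⟩ := exists_bump (n := n) x₀
    (e.open_baseSet.mem_nhds (mem_baseSet_trivializationAt G V x₀))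
  obtain ⟨φ, -, hφ⟩ := exists_dual_vector ℝ (fib G V x₀ x₀ (p.1 ρ))
    (fun h => hne (fib_eq_zero_iff.1 (norm_eq_zero.1 h)))
  -- a scalar function that vanishes with `p` and detects the value of `p` at `ρ`
  let q : Gam n F E ℝ (Bundle.Trivial M ℝ) :=
    ⟨fun ρ' => χ ρ'.base * φ (fib G V x₀ ρ'.base (p.1 ρ')), by
      obtain ⟨p, k, hk⟩ := p
      refine ⟨k, fun x₁ => ?_⟩
      obtain ⟨g, hg, h⟩ := hk x₁
      obtain ⟨H, hH, h2⟩ := exists_contDiff_chart (contMDiffAt_bump_transition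
        (trivializationAt G V x₁) e hχ fun h => ⟨mem_baseSet_trivializationAt G V x₁, hs h⟩)
      refine ⟨fun z => φ (H z.2.1 (g z)), ?_, ?_⟩
      · exact φ.contDiff.comp ((hH.comp (contDiff_fst.comp contDiff_snd)).clm_apply hg)
      · filter_upwards [h, h2, (trivializationAt G V x₁).open_baseSet.mem_nhds
          (mem_baseSet_trivializationAt G V x₁)] with x h3 h4 h5 s t
        have h6 : fib ℝ (Bundle.Trivial M ℝ) x₁ x = ContinuousLinearMap.id ℝ ℝ :=
          Bundle.Trivial.continuousLinearMapAt_trivialization ℝ M ℝ x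
        rw [h6]
        have h7 : (trivializationAt G V x₁).symmL ℝ x (fib G V x₁ x (p (pt x s t))) = p (pt x s t) :=
          (trivializationAt G V x₁).symmL_continuousLinearMapAt (R := ℝ) h5 _
        change χ x * φ (fib G V x₀ x (p (pt x s t))) = φ (H (chartAt (Eu n) x₁ x) (g (t, _, _)))
        rw [h4, ← h3 s t]
        change _ = φ (χ x • e.continuousLinearMapAt ℝ x
          ((trivializationAt G V x₁).symmL ℝ x (fib G V x₁ x (p (pt x s t)))))
        rw [h7, map_smul]
        rfl⟩
  have hq : Continuous (q.1 : EInf n F E → ℝ) := continuous_iInf_dom (i := q) continuous_induced_dom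
  have h0 : (q.1 : EInf n F E → ℝ) = fun _ => 0 := by
    refine Continuous.ext_on hU hq continuous_const fun ρ' hρ' => ?_
    change χ ρ'.base * φ (fib G V x₀ ρ'.base (p.1 ρ')) = 0
    rw [hp ρ' hρ', map_zero, map_zero, mul_zero]
  have h2 : χ x₀ * φ (fib G V x₀ x₀ (p.1 ρ)) = 0 := congrFun h0 ρ
  rw [h1, one_mul, hφ] at h2
  exact hne (fib_eq_zero_iff.1 (norm_eq_zero.1 (by simpa using h2)))

end Extension

/-! ### Invariant multidifferential operators -/

section Invariant

variable {n : ℕ} {M : Type*} [TopologicalSpace M] [ChartedSpace (Eu n) M] [IsManifold (𝓡 n) ∞ M]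
  {F : Type*} [NormedAddCommGroup F] [NormedSpace ℝ F]
  {E : M → Type*} [TopologicalSpace (TotalSpace F E)] [∀ x, AddCommGroup (E x)]
  [∀ x, Module ℝ (E x)] [∀ x, TopologicalSpace (E x)] [FiberBundle F E] [VectorBundle ℝ F E]
  {G : Type*} [NormedAddCommGroup G] [NormedSpace ℝ G]
  {V : M → Type*} [TopologicalSpace (TotalSpace G V)] [∀ x, AddCommGroup (V x)]
  [∀ x, Module ℝ (V x)] [∀ x, TopologicalSpace (V x)] [FiberBundle G V] [VectorBundle ℝ G V]
  {G₁ : Type*} [NormedAddCommGroup G₁] [NormedSpace ℝ G₁]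
  {V₁ : M → Type*} [TopologicalSpace (TotalSpace G₁ V₁)] [∀ x, AddCommGroup (V₁ x)]
  [∀ x, Module ℝ (V₁ x)] [∀ x, TopologicalSpace (V₁ x)] [FiberBundle G₁ V₁] [VectorBundle ℝ G₁ V₁]
  {G₂ : Type*} [NormedAddCommGroup G₂] [NormedSpace ℝ G₂]
  {V₂ : M → Type*} [TopologicalSpace (TotalSpace G₂ V₂)] [∀ x, AddCommGroup (V₂ x)]
  [∀ x, Module ℝ (V₂ x)] [∀ x, TopologicalSpace (V₂ x)] [FiberBundle G₂ V₂] [VectorBundle ℝ G₂ V₂]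

theorem fnDelta_iterate_add {D Δ : Module.End ℝ (Gam n F E G V)} {a : C^∞⟮𝓡 n, M; 𝓘(ℝ), ℝ⟯}
    (hD : fnDelta a D = 0) {l : ℕ} (hl : 1 ≤ l) : (fnDelta a)^[l] (D + Δ) = (fnDelta a)^[l] Δ := by
  obtain ⟨l, rfl⟩ := Nat.exists_eq_add_of_le' hl
  rw [Function.iterate_succ_apply, Function.iterate_succ_apply]
  congr 1
  exact (opDelta_add _ _ a D Δ).trans (by
    rw [show opDelta (mulBase n F E G V) (mulBase n F E G V) a D = 0 from hD, zero_add])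

variable [ContMDiffVectorBundle ∞ F E (𝓡 n)]

theorem OrderLT.neg {m : ℕ} {Δ : Gam n F E G₁ V₁ →ₗ[ℝ] Gam n F E G₂ V₂} (h : OrderLT m Δ) :
    OrderLT m (-Δ) := fun p x s t hp => neg_eq_zero.2 (h p x s t hp)

/-- Adding to an operator of positive order one that commutes with the functions on `M`, as the
total derivative `D_t` does, changes neither its order nor its symbols. -/
theorem OrderLT.hasOrder_add {l : ℕ} (hl : 1 ≤ l) {R : Module.End ℝ (Gam n F E G V) → Prop}
    (hR : ∀ Δ, OrderLT 1 Δ → R Δ) {D Δ : Module.End ℝ (Gam n F E G V)}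
    (hD : ∀ a, EvolEq.fnDelta a D = 0) (h : OrderLT (l + 1) Δ) :
    HasOrder (opDelta (mulBase n F E G V) (mulBase n F E G V)) R l (D + Δ) := by
  obtain ⟨l, rfl⟩ := Nat.exists_eq_add_of_le' hl
  intro a
  rw [opDelta_add, show opDelta (mulBase n F E G V) (mulBase n F E G V) a D = 0 from hD a, zero_add]
  exact h.hasOrder hR a

/-- A multidifferential operator is multilinear, with a common bound on the orders. -/
theorem IsMultiCDiff.exists_multilinearMap {r : ℕ}
    {A : (Fin r → Gam n F E G₁ V₁) → Gam n F E G₂ V₂} (hA : IsMultiCDiff A) :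
    ∃ (B : MultilinearMap ℝ (fun _ : Fin r => Gam n F E G₁ V₁) (Gam n F E G₂ V₂)) (l : ℕ),
      (∀ ξ, B ξ = A ξ) ∧ ∀ ξ i, OrderLT l (B.toLinearMap ξ i) := by
  obtain ⟨l, hA⟩ := hA
  have h := fun i ξ => (hA i ξ).exists_linearMap
  refine ⟨MultilinearMap.mk' A (fun ξ i p q => ?_) (fun ξ i c p => ?_), l + 1, fun _ => rfl,
    fun ξ i => ?_⟩
  · obtain ⟨T, hT, -⟩ := h i ξ
    rw [← hT, ← hT, ← hT, map_add]
  · obtain ⟨T, hT, -⟩ := h i ξ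
    rw [← hT, ← hT, map_smul]
  · obtain ⟨T, hT, ho⟩ := h i ξ
    refine fun p x s t hp => ?_
    have := ho p x s t hp
    rwa [hT] at this

/-- A multidifferential operator of at least two arguments that is invariant under operators
`D + Δ` and `D' + Δ'` of order `l ≥ 2` vanishes, if the symbol of `Δ` is injective on a dense
subset. -/
theorem eq_zero_of_invarianceEq [T2Space M] [ContMDiffVectorBundle ∞ G₂ V₂ (𝓡 n)] {r : ℕ}
    (hr : 2 ≤ r) {A : (Fin r → Gam n F E G₁ V₁) → Gam n F E G₂ V₂} (hA : IsMultiCDiff A)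
    {D Δ : Module.End ℝ (Gam n F E G₂ V₂)} {D' Δ' : Module.End ℝ (Gam n F E G₁ V₁)}
    (hD : ∀ a, fnDelta a D = 0) (hD' : ∀ a, fnDelta a D' = 0) {l : ℕ} (hl : 2 ≤ l)
    (hΔ : OrderLT (l + 1) Δ) (hΔ' : OrderLT (l + 1) Δ') {U : Set (EInf n F E)} (hU : Dense U)
    (hsymb : ∀ ρ ∈ U, ∃ a, ∀ q, ((fnDelta a)^[l] Δ q).1 ρ = 0 → q.1 ρ = 0)
    (h : InvarianceEq (D + Δ) (D' + Δ') A) : A = 0 := by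
  obtain ⟨B, m, hB, hm⟩ := hA.exists_multilinearMap
  have hne : (⟨0, by omega⟩ : Fin r) ≠ ⟨1, by omega⟩ := Fin.ne_of_val_ne (by simp)
  have hB0 : B = 0 := by
    refine eq_zero_of_invOp_eq_zero (C := C^∞⟮𝓡 n, M; 𝓘(ℝ), ℝ⟯) commute_mulBase
      commute_mulBase hne hl
      (S := {Z | ∃ ρ ∈ U, Z = vanishAt G₂ V₂ ρ}) (fun q hq => ?_) (N := D + Δ) (N' := D' + Δ') ?_
      (hΔ'.hasOrder_add (by omega) (fun _ _ => trivial) hD') ?_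
      (word_eq_zero_of_slots commute_mulBase commute_mulBase (m := m) fun i w hw =>
        word_slot_eq_zero i w B fun ξ => hw ▸ hm ξ i) ?_
    · exact eq_zero_of_dense hU fun ρ hρ => hq _ ⟨ρ, hρ, rfl⟩
    · rintro _ ⟨ρ, -, rfl⟩
      exact hΔ.hasOrder_add (by omega) (fun T hT => hT.mem_vanishAt ρ) hD
    · rintro _ ⟨ρ, hρ, rfl⟩
      obtain ⟨a, ha⟩ := hsymb ρ hρ
      refine ⟨a, fun q hq => ha q ?_⟩
      rw [← fnDelta_iterate_add (hD a) (by omega)]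
      exact hq
    · ext1 ξ
      rw [invOp_apply]
      simp only [hB]
      exact h ξ
  funext ξ
  rw [← hB, hB0]
  rfl

end Invariant

end EvolEq

theorem mainTheorem1 {n : ℕ} {M : Type*} [TopologicalSpace M] [T2Space M] [SigmaCompactSpace M]
    [ChartedSpace (EvolEq.Eu n) M] [IsManifold (𝓡 n) ∞ M]
    {F : Type*} [NormedAddCommGroup F] [NormedSpace ℝ F] [FiniteDimensional ℝ F]
    {E : M → Type*} [TopologicalSpace (TotalSpace F E)] [∀ x, AddCommGroup (E x)]
    [∀ x, Module ℝ (E x)] [∀ x, TopologicalSpace (E x)] [∀ x, IsTopologicalAddGroup (E x)]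
    [∀ x, ContinuousSMul ℝ (E x)] [FiberBundle F E] [VectorBundle ℝ F E]
    [ContMDiffVectorBundle ∞ F E (𝓡 n)]
    (f : EvolEq.Kappa n F E)
    (adj : EvolEq.KappaHat n F E → EvolEq.KappaHat n F E)
    (hadj : EvolEq.IsAdjoint (EvolEq.lin f) adj)
    (hord : 1 < EvolEq.ord (EvolEq.lin f))
    (hsymbol : ∃ U : Set (EvolEq.EInf n F E), IsOpen U ∧ Dense U ∧
      ∀ ρ ∈ U, EvolEq.SymbolNonsingularAt (EvolEq.ord (EvolEq.lin f)) (EvolEq.lin f) ρ)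
    (k : ℕ) (hk : 3 ≤ k) :
    (∀ A : (Fin (k - 1) → EvolEq.KappaHat n F E) → EvolEq.Kappa n F E, EvolEq.IsMultiCDiff A →
      EvolEq.InvarianceEq (EvolEq.linEq f) (EvolEq.adjLinEq f adj) A → A = 0) ∧
    (∀ A : (Fin (k - 1) → EvolEq.Kappa n F E) → EvolEq.KappaHat n F E, EvolEq.IsMultiCDiff A →
      EvolEq.InvarianceEq (EvolEq.adjLinEq f adj) (EvolEq.linEq f) A → A = 0) ∧
    (∀ A : (Fin (k - 1) → EvolEq.KappaHat n F E) → EvolEq.Kappa n F E,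
      EvolEq.IsVariationalVector f adj k A → A = 0) ∧
    (∀ A : (Fin (k - 1) → EvolEq.Kappa n F E) → EvolEq.KappaHat n F E,
      EvolEq.IsVariationalForm f adj k A → A = 0) := by
  have hlord : EvolEq.IsCDiffOfOrder (EvolEq.ord (EvolEq.lin f)) (EvolEq.lin f) :=
    Nat.sInf_mem hadj.1
  set l := EvolEq.ord (EvolEq.lin f) with hl
  obtain ⟨L, hL, hLo⟩ := hlord.exists_linearMap
  obtain ⟨T, hT, hTo⟩ := hadj.exists_linearMap hlord
  obtain ⟨U, -, hU, hsymb⟩ := hsymbol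
  have hLf : (L : EvolEq.Kappa n F E → EvolEq.Kappa n F E) = EvolEq.lin f := funext hL
  have hTa : (T : EvolEq.KappaHat n F E → EvolEq.KappaHat n F E) = adj := funext hT
  have hLT : EvolEq.IsAdjoint L T := by rw [hLf, hTa]; exact hadj
  have hlL : EvolEq.IsCDiffOfOrder l L := by rw [hLf]; exact hlord
  have e1 : EvolEq.linEq f =
      ⇑(EvolEq.totalTLin f + -L : Module.End ℝ (EvolEq.Kappa n F E)) := by
    funext p
    exact (congrArg (EvolEq.totalT f p - ·) (hL p).symm).trans (sub_eq_add_neg _ _)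
  have e2 : EvolEq.adjLinEq f adj =
      ⇑(-EvolEq.totalTLin f + -T : Module.End ℝ (EvolEq.KappaHat n F E)) := by
    funext q
    exact (congrArg (-EvolEq.totalT f q - ·) (hT q).symm).trans (sub_eq_add_neg _ _)
  have hD : ∀ a, EvolEq.fnDelta a (EvolEq.totalTLin f : Module.End ℝ (EvolEq.Kappa n F E)) = 0 :=
    EvolEq.fnDelta_totalTLin f
  have hD' : ∀ a, EvolEq.fnDelta a
      (-EvolEq.totalTLin f : Module.End ℝ (EvolEq.KappaHat n F E)) = 0 := fun a =>
    (EvolEq.opDelta_iterate_neg _ _ a 1 _).trans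
      (neg_eq_zero.2 (EvolEq.fnDelta_totalTLin f a))
  have h1 : ∀ A : (Fin (k - 1) → EvolEq.KappaHat n F E) → EvolEq.Kappa n F E,
      EvolEq.IsMultiCDiff A →
      EvolEq.InvarianceEq (EvolEq.linEq f) (EvolEq.adjLinEq f adj) A → A = 0 := by
    intro A hA h
    rw [e1, e2] at h
    refine EvolEq.eq_zero_of_invarianceEq (by omega) hA hD hD' hord hLo.neg hTo.neg hU
      (fun ρ hρ => ?_) h
    obtain ⟨a, S, hS⟩ := hsymb ρ hρ
    refine ⟨a, fun q hq => ?_⟩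
    rw [EvolEq.opDelta_iterate_neg] at hq
    have h2 : ((EvolEq.fnDelta a)^[l] L q).1 ρ = 0 := neg_eq_zero.1 hq
    rw [EvolEq.coe_fnDelta_iterate, hLf, hS] at h2
    exact (LinearEquiv.map_eq_zero_iff S).1 h2
  have h2 : ∀ A : (Fin (k - 1) → EvolEq.Kappa n F E) → EvolEq.KappaHat n F E,
      EvolEq.IsMultiCDiff A →
      EvolEq.InvarianceEq (EvolEq.adjLinEq f adj) (EvolEq.linEq f) A → A = 0 := by
    intro A hA h
    rw [e1, e2] at h
    refine EvolEq.eq_zero_of_invarianceEq (by omega) hA hD' hD hord hTo.neg hLo.neg hU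
      (fun ρ hρ => ?_) h
    obtain ⟨x, s, t, rfl⟩ : ∃ x s t, ρ = EvolEq.pt x s t := ⟨_, _, _, ρ.pt_eta.symm⟩
    obtain ⟨a, S, hS⟩ := hsymb _ hρ
    refine ⟨a, fun q hq => ?_⟩
    rw [EvolEq.opDelta_iterate_neg] at hq
    have h3 : ((EvolEq.fnDelta a)^[l] T q).1 (EvolEq.pt x s t) = 0 := neg_eq_zero.1 hq
    obtain ⟨Λ, hΛ, hΛ'⟩ := hLT.exists_symbol hlL a x s t
    have h4 := (hΛ' q).symm.trans (EvolEq.fib_eq_zero_iff.2 h3)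
    have h5 : (EvolEq.fib (EvolEq.HatModel n F) (EvolEq.Hat n E) x x
        (q.1 (EvolEq.pt x s t))).comp Λ = 0 :=
      (smul_eq_zero_iff_right (pow_ne_zero l (by norm_num : (-1 : ℝ) ≠ 0))).1 h4
    refine (EvolEq.fib_eq_zero_iff (G := EvolEq.HatModel n F) (V := EvolEq.Hat n E)).1
      (ContinuousLinearMap.ext fun w : F => ?_)
    -- the symbol of the linearization is onto, as every vector is a value of a section
    obtain ⟨p, hp⟩ := EvolEq.exists_gam_apply_eq (G := F) (V := E) (EvolEq.pt x s t)
      (S.symm ((trivializationAt F E x).symmL ℝ x w))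
    have h6 := (hS p).trans ((congrArg S hp).trans (S.apply_symm_apply _))
    rw [← hLf, ← EvolEq.coe_fnDelta_iterate] at h6
    have h7 := hΛ p
    have h8 := (congrArg (EvolEq.fib F E x x) h6).trans
      ((trivializationAt F E x).continuousLinearMapAt_symmL (R := ℝ)
        (mem_baseSet_trivializationAt F E x) w)
    have h9 := congrArg (fun Θ : F →L[ℝ] EvolEq.TopModel n =>
      Θ (EvolEq.fib F E x x (p.1 (EvolEq.pt x s t)))) h5
    exact (congrArg (EvolEq.fib (EvolEq.HatModel n F) (EvolEq.Hat n E) x x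
      (q.1 (EvolEq.pt x s t))) (h8.symm.trans h7)).trans h9
  refine ⟨h1, h2, fun A hA => h1 A hA.multi fun ξ => ?_, fun A hA => h2 A hA.multi fun ξ => ?_⟩
  · obtain ⟨B, -, hB, -⟩ := hA.multi.exists_multilinearMap
    have h3 : ∀ i, A (Function.update ξ i (EvolEq.adjLinEq f adj (ξ i))) =
        -A (Function.update ξ i (EvolEq.lieHat f adj (ξ i))) := fun i => by
      have h4 : EvolEq.adjLinEq f adj (ξ i) = -EvolEq.lieHat f adj (ξ i) := by
        rw [EvolEq.adjLinEq, EvolEq.lieHat]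
        abel
      rw [h4, ← hB, ← hB, B.map_update_neg]
    simp only [h3, Finset.sum_neg_distrib]
    rw [← sub_eq_add_neg]
    exact hA.invariant ξ
  · have h3 : EvolEq.adjLinEq f adj (A ξ) = -EvolEq.lieHat f adj (A ξ) := by
      rw [EvolEq.adjLinEq, EvolEq.lieHat]
      abel
    rw [h3, neg_add_eq_zero]
    exact sub_eq_zero.1 (hA.invariant ξ)
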